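/- Let $P=\langle \mathcal S\mid\mathcal R\rangle$ be a finite group presentation (finitely many generators, finitely many relators), and let $G=\mathrm{Cay}(P)$ be its Cayley graph, i.e. the simple graph whose vertices are the elements of the presented group and in which distinct $g,h$ are adjacent if and only if $h=gs$ or $g=hs$ for some $s\in\mathcal S$. Assume that $G$ is 1-ended. Let $d$ be the degree of $G$, let $t$ be the maximal length of a relator in $\mathcal R$ (each relator being a reduced word, whose translates are closed walks of $G$), and put $$\gamma_P=\bigl((2d-2)^{\lfloor t/2\rfloor}-1\bigr)e .$$ For $p\in[0,1]$ and a vertex $o$ of $G$, let $\theta_o(p)=\Pr_p(|C(o)|=\infty)$ be the probability that the cluster $C(o)$ of $o$ is infinite in Bernoulli bond percolation on $G$, in which every edge is kept independently with probability $p$. Let $$p_{\mathbb C}=\inf\{p\in[0,1] : \theta_o \text{ is analytic in } (p,1]\},$$ where analyticity at the endpoint $1$ means that $\theta_o$ agrees with the sum of a convergent power series centred at $1$ on some interval $(1-r,1]$, $r>0$. Then, for every vertex $o$, the function $\theta_o$ is analytic in $(1-1/\gamma_P,\,1]$. Consequently $p_{\mathbb C}\le 1-1/\gamma_P$, and $p_{\mathbb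 C}<1$. -/

import Mathlib

open MeasureTheory ProbabilityTheory

noncomputable section

namespace BondPercolation

variable {V : Type*}

/-- The law `Pr_p` of Bernoulli bond percolation with parameter `p ∈ [0,1]` on `G`: the product
measure on `{0,1}^E` under which every edge is independently occupied (`true`) with probability
`p` and vacant (`false`) with probability `1 - p`. -/
def law (G : SimpleGraph V) (p : unitInterval) : Measure (G.edgeSet → Bool) :=
  Measure.infinitePi fun _ : G.edgeSet => bernoulliMeasure true false p

/-- The spanning subgraph of `G` formed by the edges that are occupied in the instance `ω`. -/
def occupied (G : SimpleGraph V) (ω : G.edgeSet → Bool) : SimpleGraph V :=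
  SimpleGraph.fromEdgeSet {e | ∃ h : e ∈ G.edgeSet, ω ⟨e, h⟩ = true}

/-- The cluster `C(o)`: the vertex set of the component of `o` in the occupied subgraph. -/
def cluster (G : SimpleGraph V) (ω : G.edgeSet → Bool) (o : V) : Set V :=
  {x | (occupied G ω).Reachable o x}

/-- The percolation density `θ_o(p) = Pr_p(|C(o)| = ∞)` for `p ∈ [0,1]`, extended to all real `p`
by projecting `p` to `[0,1]` (only its values on subsets of `[0,1]` are ever used). -/
def theta (G : SimpleGraph V) (o : V) (p : ℝ) : ℝ :=
  (law G (Set.projIcc 0 1 zero_le_one p)).real {ω | (cluster G ω o).Infinite}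

/-- The threshold `p_ℂ`: the infimum of those `p ∈ [0,1]` for which `θ_o` is (real-)analytic in
`(p,1]`. Analyticity is relative to that interval, i.e. at `1` it is one-sided: `θ_o` is the sum of
a power series centred at `1` on some interval `(1 - r, 1]`. -/
def pAnalytic (G : SimpleGraph V) (o : V) : ℝ :=
  sInf {p : ℝ | 0 ≤ p ∧ p ≤ 1 ∧ AnalyticOn ℝ (theta G o) (Set.Ioc p 1)}

/-- `G` is 1-ended: it has exactly one end. -/
def OneEnded (G : SimpleGraph V) : Prop :=
  Nat.card G.end = 1

variable {α : Type*}

/-- The Cayley graph of the presentation `⟨α | rels⟩`: the vertices are the elements of the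
presented group, and distinct `g`, `h` are adjacent if and only if `h = g s` or `g = h s` for some
generator `s`. -/
def cayleyGraph (rels : Finset (FreeGroup α)) :
    SimpleGraph (PresentedGroup (rels : Set (FreeGroup α))) :=
  SimpleGraph.mulCayley
    (Set.range (PresentedGroup.of : α → PresentedGroup (rels : Set (FreeGroup α))))

/-- The degree `d` of the Cayley graph (it is the same at all vertices). -/
def cayleyDegree (rels : Finset (FreeGroup α)) : ℕ :=
  ((cayleyGraph rels).neighborSet 1).ncard

/-- The length `t` of the longest relator, i.e. of the longest of the closed walks of the Cayley
graph that the relators induce. -/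
def maxRelatorLength [DecidableEq α] (rels : Finset (FreeGroup α)) : ℕ :=
  rels.sup FreeGroup.norm

/-- The constant `γ_P = ((2d - 2)^⌊t/2⌋ - 1) e`; here `t / 2` is division of natural numbers,
which rounds down. -/
def gammaP [DecidableEq α] (rels : Finset (FreeGroup α)) : ℝ :=
  ((2 * (cayleyDegree rels : ℝ) - 2) ^ (maxRelatorLength rels / 2) - 1) * Real.exp 1

end BondPercolation

end

/-! Call two edges neighbours if their distance in the line graph is at most `t / 2`. An edge has at
most `D = (2d-2)^(t/2)` neighbours, and `γ_P = (D-1)e` is `animalRate D`. Vacant clusters are taken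
with respect to this relation.

Topology. If `C(o)` is finite, filling its holes gives a finite set `K` such that `K` and its
complement are both connected; this is where one-endedness enters (`exists_tied_hull`). The boundary
of `K` is vacant and linked (`edgeBoundary_connected`): a part of it closed under neighbours meets
every relator evenly, hence is a coboundary mod 2, hence is empty or everything. So, when there are
no infinite vacant clusters, `C(o)` is finite iff some finite vacant cluster `W` contains the
boundary of a finite set around `o` (`cluster_finite_iff`).

Counting. The events that a given linked `W ∋ e` is the vacant cluster of `e` are disjoint, so their
probabilities sum to at most 1. A suitable `p` turns this into `∑ γ_P^(-|W|) ≤ 4` (`sum_grows_le`).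
Hence infinite vacant clusters almost surely do not occur for `p > 1 - 1/γ_P`. The sum of `x^|W|`
over all `W` surrounding `o` also converges for `x < 1/γ_P`, because such a `W` meets a geodesic
through `o` at distance `O(|W|)` (`summable_surrounding`).

Analyticity. `θ_o(p)` is the probability that no surrounding `W` is a vacant cluster.
Inclusion-exclusion expands it over finite families of sets `W`, each term being a polynomial in
`p`. Incompatible families contribute zero and compatible ones consist of disjoint sets, so near a
real `p ≤ 1` the terms are dominated by `∏ x^|W|` with `x` close to `1 - p`. These products are
summable, and the Weierstrass theorem makes the sum holomorphic
(`analyticOn_measure_forall_notMem_isolated`). -/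

noncomputable section

namespace BondPercolation

/-! ### Finite connected sets in a locally finite neighbourhood structure -/

section Animals

variable {E : Type*} [DecidableEq E] (nb : E → Finset E)

/-- The outer boundary of a finite set `W`: the neighbours of elements of `W` outside `W`. -/
def outer (W : Finset E) : Finset E := W.biUnion nb \ W

/-- A finite set is linked if it is nonempty and has no proper nonempty subset that is closed under
taking neighbours inside the set. -/
def Linked (W : Finset E) : Prop :=
  W.Nonempty ∧ ∀ A ⊆ W, A.Nonempty → (∀ a ∈ A, ∀ b ∈ W, b ∈ nb a → b ∈ A) → A = W

/-- The finite sets that can be grown from `e` by successively adding boundary elements. -/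
inductive Grows (e : E) : Finset E → Prop
  | single : Grows e {e}
  | insert {W : Finset E} {v : E} : Grows e W → v ∈ outer nb W → Grows e (insert v W)

variable {nb}

theorem mem_outer {W : Finset E} {v : E} : v ∈ outer nb W ↔ (∃ u ∈ W, v ∈ nb u) ∧ v ∉ W := by
  simp [outer]

theorem Grows.mem {e : E} {W : Finset E} (h : Grows nb e W) : e ∈ W := by
  induction h with
  | single => simp
  | insert _ _ ih => exact Finset.mem_insert_of_mem ih

theorem Grows.linked (hs : ∀ a b, a ∈ nb b → b ∈ nb a) {e : E} {W : Finset E}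
    (h : Grows nb e W) : Linked nb W := by
  induction h with
  | single =>
    exact ⟨by simp, fun A hA hne _ => (Finset.subset_singleton_iff.1 hA).resolve_left hne.ne_empty⟩
  | @insert W v _ hv ih =>
    obtain ⟨⟨u, hu, hvu⟩, hvW⟩ := mem_outer.1 hv
    refine ⟨by simp, fun A hA hne hcl => ?_⟩
    -- A closed subset missing `W` could only be `{v}`, but symmetry of the relation puts `u` into
    -- it.
    have key : (A ∩ W).Nonempty := by
      by_contra hem
      have hAv : A ⊆ {v} := fun a ha => by
        rcases Finset.mem_insert.1 (hA ha) with h | h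
        · simp [h]
        · exact absurd ⟨a, Finset.mem_inter.2 ⟨ha, h⟩⟩ hem
      have hAe : A = {v} := (Finset.subset_singleton_iff.1 hAv).resolve_left hne.ne_empty
      have := hcl v (by simp [hAe]) u (Finset.mem_insert_of_mem hu) (hs _ _ hvu)
      exact hem ⟨u, Finset.mem_inter.2 ⟨this, hu⟩⟩
    have hAW := ih.2 (A ∩ W) Finset.inter_subset_right key (fun a ha b hb hab => by
      have ha' := Finset.mem_inter.1 ha
      exact Finset.mem_inter.2 ⟨hcl a ha'.1 b (Finset.mem_insert_of_mem hb) hab, hb⟩)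
    have hWA : W ⊆ A := fun w hw => by
      rw [← hAW] at hw
      exact (Finset.mem_inter.1 hw).1
    refine Finset.Subset.antisymm hA (Finset.insert_subset ?_ hWA)
    exact hcl u (hWA hu) v (by simp) hvu

/-- A set `B` containing `e` either contains sets grown from `e` of every size, or a grown set that
is closed under taking neighbours in `B`. -/
theorem exists_grows_card_or_closed {e : E} {B : Set E} (he : e ∈ B) (n : ℕ) :
    (∃ W : Finset E, Grows nb e W ∧ ↑W ⊆ B ∧ W.card = n + 1) ∨
      ∃ W : Finset E, Grows nb e W ∧ ↑W ⊆ B ∧ ∀ a ∈ outer nb W, a ∉ B := by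
  induction n with
  | zero => exact Or.inl ⟨{e}, .single, by simpa using he, by simp⟩
  | succ n ih =>
    rcases ih with ⟨W, hW, hWB, hc⟩ | h
    · by_cases hcl : ∀ a ∈ outer nb W, a ∉ B
      · exact Or.inr ⟨W, hW, hWB, hcl⟩
      · push Not at hcl
        obtain ⟨a, ha, haB⟩ := hcl
        refine Or.inl ⟨insert a W, .insert hW ha, ?_, ?_⟩
        · rw [Finset.coe_insert]
          exact Set.insert_subset haB hWB
        · rw [Finset.card_insert_of_notMem (mem_outer.1 ha).2, hc]
    · exact Or.inr h

/-- Growth from `e` inside `W` cannot reach `|W| + 1` elements, so it stops at a subset closed in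
`W`, which is `W` itself. -/
theorem Linked.grows {W : Finset E} (h : Linked nb W) {e : E} (he : e ∈ W) : Grows nb e W := by
  rcases exists_grows_card_or_closed (nb := nb) (B := (W : Set E)) (by simpa using he) W.card with
    ⟨A, _, hAW, hc⟩ | ⟨A, hA, hAW, hcl⟩
  · have := Finset.card_le_card (Finset.coe_subset.1 hAW)
    omega
  · have : A = W := h.2 A (Finset.coe_subset.1 hAW) ⟨e, hA.mem⟩ (fun a ha b hb hab => by
      by_contra hbA
      exact hcl b (mem_outer.2 ⟨⟨a, ha, hab⟩, hbA⟩) (by simpa using hb))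
    exact this ▸ hA

theorem card_outer_le {D : ℕ} (hD : ∀ e, (nb e).card ≤ D) (W : Finset E) :
    (outer nb W).card ≤ D * W.card := by
  refine (Finset.card_le_card Finset.sdiff_subset).trans ?_
  rw [mul_comm]
  exact Finset.card_biUnion_le_card_mul _ _ _ fun e _ => hD e

/-- Adding `v` removes `v` from the boundary and brings in at most `D + 1` of its neighbours, as one
of them already lies in `W`. The net gain is at most `D`, which improves on the degree by 2. -/
theorem Grows.card_outer_le {D : ℕ} (hs : ∀ a b, a ∈ nb b → b ∈ nb a)
    (hD : ∀ e, (nb e).card ≤ D + 2) {e : E} {W : Finset E} (h : Grows nb e W) :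
    (outer nb W).card ≤ D * W.card + 2 := by
  induction h with
  | single =>
    refine (BondPercolation.card_outer_le hD _).trans ?_
    simp
  | @insert W v _ hv ih =>
    have hv' := mem_outer.1 hv
    obtain ⟨⟨u, hu, hvu⟩, hvW⟩ := hv'
    have hsub : outer nb (Insert.insert v W) ⊆ (outer nb W).erase v ∪ (nb v).erase u := by
      intro x hx
      obtain ⟨⟨y, hy, hxy⟩, hxW⟩ := mem_outer.1 hx
      have hxv : x ≠ v := fun h => hxW (by simp [h])
      have hxW' : x ∉ W := fun h => hxW (by simp [h])
      have hxu : x ≠ u := fun h => hxW' (h ▸ hu)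
      rcases Finset.mem_insert.1 hy with rfl | hy
      · exact Finset.mem_union_right _ (Finset.mem_erase.2 ⟨hxu, hxy⟩)
      · exact Finset.mem_union_left _ (Finset.mem_erase.2 ⟨hxv, mem_outer.2 ⟨⟨y, hy, hxy⟩, hxW'⟩⟩)
    have h1 := (Finset.card_le_card hsub).trans (Finset.card_union_le _ _)
    have h2 := Finset.card_erase_add_one hv
    have h3 := Finset.card_erase_add_one (hs _ _ hvu)
    have h4 := hD v
    rw [Finset.card_insert_of_notMem hvW, mul_add, mul_one]
    omega

end Animals

/-! ### Bernoulli product measures and cylinder events -/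

section Law

variable {E : Type*}

/-- The Bernoulli product measure on `{0,1}^E`. -/
def bernoulliLaw (E : Type*) (p : unitInterval) : Measure (E → Bool) :=
  Measure.infinitePi fun _ : E => bernoulliMeasure true false p

instance (p : unitInterval) : IsProbabilityMeasure (bernoulliLaw E p) := by
  unfold bernoulliLaw; infer_instance

/-- The event that `A` is vacant and `B` is occupied. -/
def pattern (A B : Finset E) : Set (E → Bool) :=
  {ω | (∀ e ∈ A, ω e = false) ∧ ∀ e ∈ B, ω e = true}

theorem measurableSet_pattern (A B : Finset E) : MeasurableSet (pattern A B) := by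
  have : pattern A B = (⋂ e ∈ A, (fun ω : E → Bool => ω e) ⁻¹' {false}) ∩
      ⋂ e ∈ B, (fun ω : E → Bool => ω e) ⁻¹' {true} := by
    ext ω; simp [pattern]
  rw [this]
  exact (Finset.measurableSet_biInter _ fun e _ => measurable_pi_apply e (by measurability)).inter
    (Finset.measurableSet_biInter _ fun e _ => measurable_pi_apply e (by measurability))

theorem bernoulliLaw_real_pattern [DecidableEq E] {A B : Finset E} (h : Disjoint A B) (p : unitInterval) :
    (bernoulliLaw E p).real (pattern A B) = (1 - (p : ℝ)) ^ A.card * (p : ℝ) ^ B.card := by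
  have : pattern A B = Set.pi (↑(A ∪ B) : Set E)
      (fun e => if e ∈ A then ({false} : Set Bool) else {true}) := by
    ext ω
    simp only [pattern, Set.mem_ofPred_eq, Set.mem_pi, Finset.coe_union, Set.mem_union,
      Finset.mem_coe]
    constructor
    · rintro ⟨h1, h2⟩ e he
      by_cases heA : e ∈ A
      · simp [heA, h1 e heA]
      · simp [heA, h2 e (he.resolve_left heA)]
    · intro hω
      refine ⟨fun e he => by simpa [he] using hω e (Or.inl he), fun e he => ?_⟩
      have : e ∉ A := fun h' => (Finset.disjoint_left.1 h) h' he
      simpa [this] using hω e (Or.inr he)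
  rw [this, measureReal_def, bernoulliLaw, Measure.infinitePi_pi _ (by measurability),
    ENNReal.toReal_prod, Finset.prod_union h]
  congr 1
  · rw [Finset.prod_congr rfl (g := fun _ => 1 - (p : ℝ)), Finset.prod_const]
    intro e he
    simp [he]
  · rw [Finset.prod_congr rfl (g := fun _ => (p : ℝ)), Finset.prod_const]
    intro e he
    have : e ∉ A := fun h' => (Finset.disjoint_left.1 h) h' he
    simp [this]

theorem pattern_eq_empty {A B : Finset E} (h : ¬ Disjoint A B) : pattern A B = ∅ := by
  obtain ⟨e, hA, hB⟩ := Finset.not_disjoint_iff.1 h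
  refine Set.eq_empty_iff_forall_notMem.2 fun ω hω => ?_
  have h1 := hω.1 e hA
  rw [hω.2 e hB] at h1
  cases h1

end Law

/-! ### Vacant clusters -/

section Clusters

variable {E : Type*} [DecidableEq E] {nb : E → Finset E}

variable (nb) in
/-- The event that `W` is a union of vacant clusters: `W` is vacant and its boundary occupied. -/
def isolated (W : Finset E) : Set (E → Bool) := pattern W (outer nb W)

/-- A step inside `W` leaving `W'` would land in `outer nb W'`, so `W ∩ W'` is closed in `W`. -/
theorem Linked.eq_inter {W W' : Finset E} (h : Linked nb W) (hi : (W ∩ W').Nonempty)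
    (hd : Disjoint W (outer nb W')) : W ⊆ W' := by
  have : W ∩ W' = W := h.2 _ Finset.inter_subset_left hi fun a ha b hb hab => by
    refine Finset.mem_inter.2 ⟨hb, ?_⟩
    by_contra hbW
    exact Finset.disjoint_left.1 hd hb (mem_outer.2 ⟨⟨a, (Finset.mem_inter.1 ha).2, hab⟩, hbW⟩)
  exact Finset.inter_eq_left.1 this

theorem disjoint_of_mem_isolated {W W' : Finset E} {ω : E → Bool} (hω : ω ∈ isolated nb W)
    (hω' : ω ∈ isolated nb W') : Disjoint W (outer nb W') :=
  Finset.disjoint_left.2 fun e he he' => by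
    have := hω.1 e he
    rw [hω'.2 e he'] at this
    cases this

theorem Linked.eq_of_mem_isolated {W W' : Finset E} (h : Linked nb W) (h' : Linked nb W')
    (hi : (W ∩ W').Nonempty) {ω : E → Bool} (hω : ω ∈ isolated nb W)
    (hω' : ω ∈ isolated nb W') : W = W' :=
  Finset.Subset.antisymm (h.eq_inter hi (disjoint_of_mem_isolated hω hω'))
    (h'.eq_inter (by rwa [Finset.inter_comm]) (disjoint_of_mem_isolated hω' hω))

theorem disjoint_outer (W : Finset E) : Disjoint W (outer nb W) :=
  Finset.disjoint_sdiff

/-- The summands are probabilities of disjoint events: `e` has only one vacant cluster. -/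
theorem sum_isolated_le_one (hs : ∀ a b, a ∈ nb b → b ∈ nb a) (e : E) (T : Finset (Finset E))
    (hT : ∀ W ∈ T, Grows nb e W) (p : unitInterval) :
    ∑ W ∈ T, (1 - (p : ℝ)) ^ W.card * (p : ℝ) ^ (outer nb W).card ≤ 1 := by
  have h1 : ∀ W ∈ T, (1 - (p : ℝ)) ^ W.card * (p : ℝ) ^ (outer nb W).card =
      (bernoulliLaw E p).real (isolated nb W) := fun W _ =>
    (bernoulliLaw_real_pattern (disjoint_outer W) p).symm
  rw [Finset.sum_congr rfl h1, ← measureReal_biUnion_finset]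
  · exact measureReal_le_one
  · intro W hW W' hW' hne
    refine Set.disjoint_left.2 fun ω hω hω' => hne ?_
    exact ((hT W hW).linked hs).eq_of_mem_isolated ((hT W' hW').linked hs)
      ⟨e, Finset.mem_inter.2 ⟨(hT W hW).mem, (hT W' hW').mem⟩⟩ hω hω'
  · exact fun W _ => measurableSet_pattern _ _

/-- The exponential growth rate of linked sets in a structure of degree at most `D`. -/
def animalRate (D : ℕ) : ℝ := ((D : ℝ) - 1) * Real.exp 1

theorem animalRate_gt_one {D : ℕ} (hD : 2 ≤ D) : 1 < animalRate D := by
  have h1 : (2 : ℝ) ≤ D := by exact_mod_cast hD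
  have h2 : (1 : ℝ) < Real.exp 1 := by simp
  unfold animalRate
  nlinarith

theorem mul_pow_le_animalRate (D : ℕ) :
    ((D : ℝ) + 2) * (((D : ℝ) + 2) / (D + 1)) ^ D ≤ animalRate (D + 2) := by
  have h0 : (0 : ℝ) < D + 1 := by positivity
  have h1 : (((D : ℝ) + 2) / (D + 1)) ^ (D + 1) ≤ Real.exp 1 := by
    have h2 : ((D : ℝ) + 2) / (D + 1) ≤ Real.exp (1 / (D + 1)) := by
      have := Real.add_one_le_exp (1 / ((D : ℝ) + 1))
      refine le_trans (le_of_eq ?_) this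
      field_simp
      ring
    calc _ ≤ (Real.exp (1 / (D + 1))) ^ (D + 1) := by gcongr
      _ = Real.exp 1 := by
        rw [← Real.exp_nat_mul]
        congr 1
        push_cast
        field_simp
  have h3 : animalRate (D + 2) = (D + 1) * Real.exp 1 := by
    unfold animalRate; push_cast; ring
  rw [h3]
  calc ((D : ℝ) + 2) * (((D : ℝ) + 2) / (D + 1)) ^ D
      = (D + 1) * (((D : ℝ) + 2) / (D + 1)) ^ (D + 1) := by
        rw [pow_succ]; field_simp
    _ ≤ _ := by gcongr

/-- The generating function of the linked sets containing a given element converges at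
`1 / animalRate D`. -/
theorem sum_grows_le {D : ℕ} (hD2 : 2 ≤ D) (hs : ∀ a b, a ∈ nb b → b ∈ nb a)
    (hD : ∀ e, (nb e).card ≤ D) (e : E) (T : Finset (Finset E)) (hT : ∀ W ∈ T, Grows nb e W) :
    ∑ W ∈ T, (animalRate D)⁻¹ ^ W.card ≤ 4 := by
  obtain ⟨D, rfl⟩ := Nat.exists_eq_add_of_le' hD2
  have hp0 : (0 : ℝ) ≤ (D + 1) / (D + 2) := by positivity
  have hp1 : ((D : ℝ) + 1) / (D + 2) ≤ 1 := by
    rw [div_le_one (by positivity)]; linarith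
  -- Here the degree bound is `D + 2`. For this `p`, `1 / ((1-p) p^D) = (D+1) (1 + 1/(D+1))^(D+1)`,
  -- which is at most `(D+1)e`. Moreover `p ≥ 1/2`, so the additive 2 in the boundary estimate costs
  -- only a factor 4.
  let p : unitInterval := ⟨(D + 1) / (D + 2), hp0, hp1⟩
  have hq : 1 - (p : ℝ) = (D + 2 : ℝ)⁻¹ := by
    simp only [p]; field_simp; ring
  have hp2 : (1 / 2 : ℝ) ≤ p := by
    simp only [p]
    rw [div_le_div_iff₀ (by norm_num) (by positivity)]
    have : (0 : ℝ) ≤ D := by positivity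
    linarith
  have hrate := mul_pow_le_animalRate D
  have hpos : (0 : ℝ) < animalRate (D + 2) := by
    linarith [animalRate_gt_one (D := D + 2) (by omega)]
  have h1 : (animalRate (D + 2))⁻¹ ≤ (1 - (p : ℝ)) * (p : ℝ) ^ D := by
    have : (1 - (p : ℝ)) * (p : ℝ) ^ D = (((D : ℝ) + 2) * (((D : ℝ) + 2) / (D + 1)) ^ D)⁻¹ := by
      rw [hq, mul_inv, ← inv_pow, inv_div]
    rw [this]
    exact inv_anti₀ (by positivity) hrate
  have h2 : ∀ W ∈ T, (animalRate (D + 2))⁻¹ ^ W.card ≤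
      4 * ((1 - (p : ℝ)) ^ W.card * (p : ℝ) ^ (outer nb W).card) := by
    intro W hW
    have hc := (hT W hW).card_outer_le hs hD
    have hp0' : (0 : ℝ) ≤ p := hp0
    have hp1' : (p : ℝ) ≤ 1 := hp1
    have hq0 : 0 ≤ 1 - (p : ℝ) := by linarith
    calc (animalRate (D + 2))⁻¹ ^ W.card
        ≤ ((1 - (p : ℝ)) * (p : ℝ) ^ D) ^ W.card := by gcongr
      _ = (1 - (p : ℝ)) ^ W.card * (p : ℝ) ^ (D * W.card) := by rw [mul_pow, pow_mul]
      _ ≤ (1 - (p : ℝ)) ^ W.card * (4 * (p : ℝ) ^ (D * W.card + 2)) := by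
          gcongr
          rw [pow_add]
          have : (1 / 4 : ℝ) ≤ (p : ℝ) ^ 2 := by nlinarith
          have h3 : 0 ≤ (p : ℝ) ^ (D * W.card) := by positivity
          nlinarith
      _ ≤ (1 - (p : ℝ)) ^ W.card * (4 * (p : ℝ) ^ (outer nb W).card) := by
          gcongr ?_ * (4 * ?_)
          exact pow_le_pow_of_le_one hp0' hp1' hc
      _ = _ := by ring
  calc _ ≤ ∑ W ∈ T, 4 * ((1 - (p : ℝ)) ^ W.card * (p : ℝ) ^ (outer nb W).card) :=
        Finset.sum_le_sum h2
    _ ≤ 4 * 1 := by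
        rw [← Finset.mul_sum]
        gcongr
        exact sum_isolated_le_one hs e T hT p
    _ = 4 := by norm_num

end Clusters

/-! ### Absence of infinite vacant clusters -/

section Subcritical

variable {E : Type*} [DecidableEq E] {nb : E → Finset E} {D : ℕ}

variable (nb) in
/-- The event that the vacant cluster of `e` is infinite. -/
def vacantInfinite (e : E) : Set (E → Bool) :=
  {ω | ∀ n : ℕ, ∃ W, Grows nb e W ∧ (∀ a ∈ W, ω a = false) ∧ W.card = n + 1}

/-- Each such set contributes the same positive amount to a sum bounded by 4. -/
theorem finite_grows_card (hD2 : 2 ≤ D) (hs : ∀ a b, a ∈ nb b → b ∈ nb a)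
    (hD : ∀ e, (nb e).card ≤ D) (e : E) (n : ℕ) : {W | Grows nb e W ∧ W.card = n}.Finite := by
  by_contra hinf
  have hpos : 0 < animalRate D := one_pos.trans (animalRate_gt_one hD2)
  obtain ⟨m, hm⟩ := exists_nat_gt (4 * animalRate D ^ n)
  obtain ⟨T, hT, hc⟩ := Set.Infinite.exists_subset_card_eq hinf m
  have h := sum_grows_le hD2 hs hD e T fun W hW => (hT hW).1
  rw [Finset.sum_congr rfl (fun W hW => by rw [(hT hW).2]), Finset.sum_const, hc, nsmul_eq_mul,
    inv_pow, mul_inv_le_iff₀ (by positivity)] at h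
  linarith

/-- A union bound over the grown sets of size `n + 1`, which gives a geometrically decaying
estimate. -/
theorem measure_vacantInfinite (hD2 : 2 ≤ D) (hs : ∀ a b, a ∈ nb b → b ∈ nb a)
    (hD : ∀ e, (nb e).card ≤ D) (e : E) (p : unitInterval)
    (hp : (1 - (p : ℝ)) * animalRate D < 1) :
    bernoulliLaw E p (vacantInfinite nb e) = 0 := by
  have hpos : 0 < animalRate D := one_pos.trans (animalRate_gt_one hD2)
  have hq0 : 0 ≤ 1 - (p : ℝ) := by linarith [p.2.2]
  have hbound : ∀ n : ℕ, (bernoulliLaw E p).real (vacantInfinite nb e) ≤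
      4 * ((1 - (p : ℝ)) * animalRate D) ^ (n + 1) := by
    intro n
    let T := (finite_grows_card hD2 hs hD e (n + 1)).toFinset
    have hT : ∀ W ∈ T, Grows nb e W ∧ W.card = n + 1 := fun W hW => by simpa [T] using hW
    have hsub : vacantInfinite nb e ⊆ ⋃ W ∈ T, pattern W ∅ := by
      intro ω hω
      obtain ⟨W, hW, hv, hc⟩ := hω n
      simp only [Set.mem_iUnion]
      exact ⟨W, by simp [T, hW, hc], hv, by simp⟩
    calc _ ≤ (bernoulliLaw E p).real (⋃ W ∈ T, pattern W ∅) :=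
          measureReal_mono hsub (measure_ne_top _ _)
      _ ≤ ∑ W ∈ T, (bernoulliLaw E p).real (pattern W ∅) := measureReal_biUnion_finset_le _ _
      _ = ∑ W ∈ T, ((1 - (p : ℝ)) * animalRate D) ^ (n + 1) * (animalRate D)⁻¹ ^ W.card := by
          refine Finset.sum_congr rfl fun W hW => ?_
          rw [bernoulliLaw_real_pattern (by simp), (hT W hW).2, mul_pow, mul_assoc, ← mul_pow,
            mul_inv_cancel₀ hpos.ne']
          simp
      _ ≤ ((1 - (p : ℝ)) * animalRate D) ^ (n + 1) * 4 := by
          rw [← Finset.mul_sum]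
          gcongr
          exact sum_grows_le hD2 hs hD e T fun W hW => (hT W hW).1
      _ = _ := mul_comm _ _
  have hlim : Filter.Tendsto (fun n : ℕ => 4 * ((1 - (p : ℝ)) * animalRate D) ^ (n + 1))
      Filter.atTop (nhds 0) := by
    have := (tendsto_pow_atTop_nhds_zero_of_lt_one (by positivity) hp).comp
      (Filter.tendsto_add_atTop_nat 1)
    simpa using this.const_mul 4
  have h0 : (bernoulliLaw E p).real (vacantInfinite nb e) = 0 :=
    le_antisymm (ge_of_tendsto' hlim hbound) measureReal_nonneg
  exact (measureReal_eq_zero_iff).1 h0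

end Subcritical

/-! ### Analyticity of the probability that no member of a family is isolated -/

section Analytic

variable {E : Type*} [DecidableEq E] {nb : E → Finset E} {D : ℕ} {𝒲 : Set (Finset E)}

variable (nb) in
/-- The signed probability that all members of `S` are isolated, as a polynomial in `z`. -/
def signedWeight (S : Finset 𝒲) (z : ℂ) : ℂ :=
  if Disjoint (S.biUnion fun W => W.1) (S.biUnion fun W => outer nb W.1) then
    (-1) ^ S.card * ((1 - z) ^ (S.biUnion fun W => W.1).card *
      z ^ (S.biUnion fun W => outer nb W.1).card)
  else 0

theorem biInter_isolated (S : Finset 𝒲) :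
    ⋂ W ∈ S, isolated nb W.1 =
      pattern (S.biUnion fun W => W.1) (S.biUnion fun W => outer nb W.1) := by
  ext ω
  simp only [isolated, pattern, Set.mem_iInter, Set.mem_ofPred_eq, Finset.mem_biUnion]
  constructor
  · rintro h
    exact ⟨fun e ⟨W, hW, he⟩ => (h W hW).1 e he, fun e ⟨W, hW, he⟩ => (h W hW).2 e he⟩
  · rintro h W hW
    exact ⟨fun e he => h.1 e ⟨W, hW, he⟩, fun e he => h.2 e ⟨W, hW, he⟩⟩

theorem signedWeight_ofReal (S : Finset 𝒲) (p : unitInterval) :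
    signedWeight nb S ((p : ℝ) : ℂ) =
      (((-1) ^ S.card * (bernoulliLaw E p).real (⋂ W ∈ S, isolated nb W.1) : ℝ) : ℂ) := by
  rw [biInter_isolated, signedWeight]
  split_ifs with h
  · rw [bernoulliLaw_real_pattern h]
    push_cast
    ring
  · simp [pattern_eq_empty h]

theorem measureReal_biInter_compl {Ω ι : Type*} [MeasurableSpace Ω] (μ : Measure Ω)
    [IsProbabilityMeasure μ] (A : ι → Set Ω) (hA : ∀ i, MeasurableSet (A i)) (S : Finset ι) :
    μ.real (⋂ i ∈ S, (A i)ᶜ) =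
      ∑ T ∈ S.powerset, (-1 : ℝ) ^ T.card * μ.real (⋂ i ∈ T, A i) := by
  classical
  have h1 : ⋂ i ∈ S, (A i)ᶜ = (⋃ i ∈ S, A i)ᶜ := by simp
  rw [h1, probReal_compl_eq_one_sub (Finset.measurableSet_biUnion _ fun i _ => hA i),
    measureReal_biUnion_eq_sum_powerset (fun i _ => hA i),
    ← Finset.sum_filter_add_sum_filter_not S.powerset (fun T => T.Nonempty)]
  have h2 : S.powerset.filter (fun T => ¬ T.Nonempty) = {∅} := by
    ext T
    simp only [Finset.mem_filter, Finset.mem_powerset, Finset.not_nonempty_iff_eq_empty,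
      Finset.mem_singleton]
    constructor
    · exact fun h => h.2
    · rintro rfl; simp
  rw [h2, Finset.sum_singleton]
  simp only [pow_succ, mul_neg, mul_one, neg_mul, Finset.sum_neg_distrib]
  simp
  ring

/-- Disjointness makes the size of the union additive, so that the bound on `signedWeight`
factorises over the family. -/
theorem pairwiseDisjoint_of_disjoint_outer (hlink : ∀ W ∈ 𝒲, Linked nb W) {S : Finset 𝒲}
    (h : Disjoint (S.biUnion fun W => W.1) (S.biUnion fun W => outer nb W.1)) :
    (S : Set 𝒲).PairwiseDisjoint fun W => W.1 := by
  intro W hW W' hW' hne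
  have hd : ∀ U ∈ S, ∀ U' ∈ S, Disjoint U.1 (outer nb U'.1) := fun U hU U' hU' =>
    h.mono (Finset.subset_biUnion_of_mem (fun W : 𝒲 => W.1) hU)
      (Finset.subset_biUnion_of_mem (fun W : 𝒲 => outer nb W.1) hU')
  by_contra hn
  have hi : (W.1 ∩ W'.1).Nonempty := by
    rwa [Function.onFun, Finset.disjoint_iff_inter_eq_empty, ← ne_eq,
      ← Finset.nonempty_iff_ne_empty] at hn
  exact hne (Subtype.ext (Finset.Subset.antisymm
    ((hlink _ W.2).eq_inter hi (hd W hW W' hW'))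
    ((hlink _ W'.2).eq_inter (by rwa [Finset.inter_comm]) (hd W' hW' W hW))))

/-- Off the real interval `‖z‖` may exceed 1 and the boundary size is only bounded above, hence the
maximum with 1. -/
theorem norm_signedWeight_le (hlink : ∀ W ∈ 𝒲, Linked nb W) (hD : ∀ e, (nb e).card ≤ D)
    (S : Finset 𝒲) (z : ℂ) :
    ‖signedWeight nb S z‖ ≤ ∏ W ∈ S, (‖1 - z‖ * max 1 ‖z‖ ^ D) ^ W.1.card := by
  unfold signedWeight
  split_ifs with h
  · have hc := Finset.card_biUnion (pairwiseDisjoint_of_disjoint_outer hlink h)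
    have ho : (S.biUnion fun W => outer nb W.1).card ≤ D * ∑ W ∈ S, W.1.card := by
      refine Finset.card_biUnion_le.trans ?_
      rw [Finset.mul_sum]
      exact Finset.sum_le_sum fun W _ => card_outer_le hD W.1
    rw [Finset.prod_pow_eq_pow_sum, norm_mul, norm_mul, norm_pow, norm_pow, norm_pow, hc]
    simp only [norm_neg, norm_one, one_pow, one_mul]
    rw [mul_pow, ← pow_mul]
    gcongr
    calc ‖z‖ ^ (S.biUnion fun W => outer nb W.1).card
        ≤ max 1 ‖z‖ ^ (S.biUnion fun W => outer nb W.1).card := by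
          gcongr; exact le_max_right _ _
      _ ≤ _ := pow_le_pow_right₀ (le_max_left _ _) ho
  · rw [norm_zero]
    positivity

theorem differentiable_signedWeight (S : Finset 𝒲) : Differentiable ℂ (signedWeight nb S) := by
  unfold signedWeight
  split_ifs with h
  · fun_prop
  · fun_prop

/-- The partial sum over the powerset of a finite `S` is inclusion-exclusion for `S`. Powersets are
cofinal among finite collections of finite subfamilies, and continuity of the measure from above
identifies the limit. -/
theorem hasSum_signedWeight [Countable E] (p : unitInterval)
    (hsum : Summable fun S : Finset 𝒲 => signedWeight nb S ((p : ℝ) : ℂ)) :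
    HasSum (fun S : Finset 𝒲 => signedWeight nb S ((p : ℝ) : ℂ))
      ((bernoulliLaw E p).real {ω | ∀ W ∈ 𝒲, ω ∉ isolated nb W} : ℝ) := by
  have hset : {ω : E → Bool | ∀ W ∈ 𝒲, ω ∉ isolated nb W} =
      ⋂ S : Finset 𝒲, ⋂ W ∈ S, (isolated nb W.1)ᶜ := by
    ext ω
    simp only [Set.mem_ofPred_eq, Set.mem_iInter, Set.mem_compl_iff]
    exact ⟨fun h S W _ => h W.1 W.2, fun h W hW => h {⟨W, hW⟩} ⟨W, hW⟩ (by simp)⟩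
  have hmeas : ∀ S : Finset 𝒲, MeasurableSet (⋂ W ∈ S, (isolated nb W.1)ᶜ) := fun S =>
    Finset.measurableSet_biInter _ fun W _ => (measurableSet_pattern _ _).compl
  have h1 : Filter.Tendsto (fun S : Finset 𝒲 =>
      (bernoulliLaw E p).real (⋂ W ∈ S, (isolated nb W.1)ᶜ)) Filter.atTop
      (nhds ((bernoulliLaw E p).real {ω | ∀ W ∈ 𝒲, ω ∉ isolated nb W})) := by
    rw [hset]
    refine (ENNReal.tendsto_toReal (measure_ne_top _ _)).comp (tendsto_measure_iInter_atTop
      (fun S => (hmeas S).nullMeasurableSet) ?_ ⟨∅, measure_ne_top _ _⟩)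
    intro S S' hSS' ω hω
    simp only [Set.mem_iInter] at hω ⊢
    exact fun W hW => hω W (hSS' hW)
  have h2 := hsum.hasSum.comp Filter.tendsto_finset_powerset_atTop_atTop
  have h3 : (fun S : Finset 𝒲 => ∑ T ∈ S.powerset, signedWeight nb T ((p : ℝ) : ℂ)) =
      fun S : Finset 𝒲 =>
        (((bernoulliLaw E p).real (⋂ W ∈ S, (isolated nb W.1)ᶜ) : ℝ) : ℂ) := by
    funext S
    rw [measureReal_biInter_compl _ (fun W : 𝒲 => isolated nb W.1)
      fun W => measurableSet_pattern _ _]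
    simp only [signedWeight_ofReal, Complex.ofReal_sum]
  have h4 : Filter.Tendsto (fun S : Finset 𝒲 =>
      ∑ T ∈ S.powerset, signedWeight nb T ((p : ℝ) : ℂ)) Filter.atTop
      (nhds (∑' S : Finset 𝒲, signedWeight nb S ((p : ℝ) : ℂ))) := h2
  rw [h3] at h4
  rw [tendsto_nhds_unique ((Complex.continuous_ofReal.tendsto _).comp h1) h4]
  exact hsum.hasSum

theorem analyticOn_measure_forall_notMem_isolated [Countable E] (hD2 : 2 ≤ D)
    (hD : ∀ e, (nb e).card ≤ D) (hlink : ∀ W ∈ 𝒲, Linked nb W)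
    (hsum : ∀ x : ℝ, 0 ≤ x → x * animalRate D < 1 → Summable fun W : 𝒲 => x ^ W.1.card) :
    AnalyticOn ℝ (fun p : ℝ => (bernoulliLaw E (Set.projIcc 0 1 zero_le_one p)).real
      {ω | ∀ W ∈ 𝒲, ω ∉ isolated nb W}) (Set.Ioc (1 - 1 / animalRate D) 1) := by
  intro p₀ hp₀
  have hγ := animalRate_gt_one hD2
  have hγ0 : 0 < animalRate D := one_pos.trans hγ
  have hγ1 : 1 / animalRate D < 1 := by rwa [div_lt_one hγ0]
  -- The domination rate per element; it equals `1 - p₀ < 1/γ` at `p₀`, hence stays below some `x <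
  -- 1/γ` on a complex neighbourhood, also when `p₀ = 1`.
  let w : ℂ → ℝ := fun z => ‖1 - z‖ * max 1 ‖z‖ ^ D
  have hw : Continuous w := by fun_prop
  have hw0 : w p₀ = 1 - p₀ := by
    have h1 : ‖(1 : ℂ) - p₀‖ = 1 - p₀ := by
      rw [← Complex.ofReal_one, ← Complex.ofReal_sub, Complex.norm_real, Real.norm_of_nonneg]
      linarith [hp₀.2]
    have h2 : ‖(p₀ : ℂ)‖ ≤ 1 := by
      rw [Complex.norm_real, Real.norm_of_nonneg] <;> linarith [hp₀.1, hp₀.2]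
    simp only [w, h1, max_eq_left h2, one_pow, mul_one]
  obtain ⟨x, hx1, hx2⟩ : ∃ x, w p₀ < x ∧ x < 1 / animalRate D :=
    exists_between (by rw [hw0]; linarith [hp₀.1])
  have hwnn : ∀ z, 0 ≤ w z := fun z => by positivity
  have hx0 : 0 ≤ x := (hwnn _).trans hx1.le
  let U : Set ℂ := {z | w z < x}
  have hU : IsOpen U := isOpen_lt hw continuous_const
  -- This is the expansion of the convergent product `∏ (1 + x^|W|)`.
  have hS : Summable fun S : Finset 𝒲 => ∏ W ∈ S, x ^ W.1.card :=
    summable_finsetProd_of_summable_nonneg (fun W => by positivity)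
      (hsum x hx0 (by rwa [lt_div_iff₀ hγ0] at hx2))
  have hbd : ∀ (S : Finset 𝒲), ∀ z ∈ U, ‖signedWeight nb S z‖ ≤ ∏ W ∈ S, x ^ W.1.card := by
    intro S z hz
    refine (norm_signedWeight_le hlink hD S z).trans (Finset.prod_le_prod
      (fun W _ => by positivity) fun W _ => pow_le_pow_left₀ (hwnn z) (le_of_lt hz) _)
  have hF := Complex.differentiableOn_tsum_of_summable_norm hS
    (fun S => (differentiable_signedWeight (nb := nb) S).differentiableOn) hU hbd
  have hA := (hF.analyticAt (hU.mem_nhds hx1)).re_ofReal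
  have heq : ∀ p ∈ Set.Ioc (1 - 1 / animalRate D) 1, (p : ℂ) ∈ U →
      (bernoulliLaw E (Set.projIcc 0 1 zero_le_one p)).real {ω | ∀ W ∈ 𝒲, ω ∉ isolated nb W} =
        (∑' S : Finset 𝒲, signedWeight nb S (p : ℂ)).re := by
    intro p hp hpU
    have hp' : p ∈ Set.Icc (0 : ℝ) 1 := ⟨by linarith [hp.1], hp.2⟩
    have := hasSum_signedWeight (nb := nb) (Set.projIcc 0 1 zero_le_one p)
      (by
        rw [Set.projIcc_of_mem _ hp']
        exact Summable.of_norm_bounded hS fun S => hbd S _ hpU)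
    have h2 := this.tsum_eq
    have h3 : ((Set.projIcc 0 1 zero_le_one p : unitInterval) : ℝ) = p := by
      rw [Set.projIcc_of_mem _ hp']
    rw [h3] at h2
    rw [h2, Complex.ofReal_re]
  -- Agreement is needed only within the interval: beyond 1 the projection freezes the parameter.
  refine hA.analyticWithinAt.congr_of_eventuallyEq ?_ (heq p₀ hp₀ hx1)
  have hUr : {p : ℝ | (p : ℂ) ∈ U} ∈ nhdsWithin p₀ (Set.Ioc (1 - 1 / animalRate D) 1) :=
    mem_nhdsWithin_of_mem_nhds ((hU.preimage Complex.continuous_ofReal).mem_nhds hx1)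
  filter_upwards [hUr, self_mem_nhdsWithin] with p hp1 hp2
  exact heq p hp2 hp1

end Analytic

/-! ### Balls in graphs of bounded degree -/

section Balls

variable {V : Type*} (G : SimpleGraph V)

/-- The vertices different from `e` that a walk of length at most `k` from `e` reaches. -/
def puncturedBall (k : ℕ) (e : V) : Set V := {f | f ≠ e ∧ ∃ w : G.Walk e f, w.length ≤ k}

variable {G}

theorem mem_puncturedBall_comm {k : ℕ} {e f : V} :
    e ∈ puncturedBall G k f ↔ f ∈ puncturedBall G k e :=
  ⟨fun ⟨h, w, hw⟩ => ⟨h.symm, w.reverse, by simpa using hw⟩,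
    fun ⟨h, w, hw⟩ => ⟨h.symm, w.reverse, by simpa using hw⟩⟩

theorem exists_adj_dist_add_one {e f : V} (h : G.Reachable e f) (hne : f ≠ e) :
    ∃ g, G.Adj g f ∧ G.Reachable e g ∧ G.dist e g + 1 = G.dist e f := by
  obtain ⟨w, hw⟩ := h.symm.exists_walk_length_eq_dist
  cases w with
  | nil => exact absurd rfl hne
  | @cons _ g _ hadj w =>
    refine ⟨g, hadj.symm, ⟨w.reverse⟩, ?_⟩
    rw [SimpleGraph.Walk.length_cons] at hw
    rw [G.dist_comm (u := e) (v := f), ← hw, G.dist_comm]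
    refine le_antisymm (by have := SimpleGraph.dist_le w; omega) ?_
    obtain ⟨w', hw'⟩ := (SimpleGraph.Walk.reachable w).exists_walk_length_eq_dist
    have := SimpleGraph.dist_le (SimpleGraph.Walk.cons hadj w')
    rw [SimpleGraph.Walk.length_cons] at this
    omega

theorem mem_puncturedBall {k : ℕ} {e f : V} :
    f ∈ puncturedBall G k e ↔ f ≠ e ∧ G.Reachable e f ∧ G.dist e f ≤ k := by
  refine and_congr_right fun _ => ⟨fun ⟨w, hw⟩ => ⟨⟨w⟩, (SimpleGraph.dist_le w).trans hw⟩, ?_⟩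
  rintro ⟨hr, hd⟩
  obtain ⟨w, hw⟩ := hr.exists_walk_length_eq_dist
  exact ⟨w, hw ▸ hd⟩

/-- `par f` precedes `f` on a geodesic from `e`. Discarding it leaves at most `Δ - 1` neighbours per
vertex, which is what gives the bound `Δ ^ k` for the ball without its centre. -/
theorem puncturedBall_succ_subset (k : ℕ) (e : V) (par : V → V)
    (hpar : ∀ f, G.Reachable e f → f ≠ e → G.dist e (par f) + 1 = G.dist e f) :
    puncturedBall G (k + 1) e ⊆
      G.neighborSet e ∪ ⋃ f ∈ puncturedBall G k e, G.neighborSet f \ {par f} := by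
  intro f hf
  obtain ⟨hne, hr, hd⟩ := mem_puncturedBall.1 hf
  obtain ⟨g, hadj, hrg, hdg⟩ := exists_adj_dist_add_one hr hne
  by_cases hge : g = e
  · exact Or.inl (hge ▸ hadj)
  · refine Or.inr (Set.mem_biUnion (mem_puncturedBall.2 ⟨hge, hrg, by omega⟩) ⟨hadj, ?_⟩)
    rintro rfl
    have := hpar g hrg hge
    omega

theorem puncturedBall_zero (e : V) : puncturedBall G 0 e = ∅ := by
  refine Set.eq_empty_iff_forall_notMem.2 fun f ⟨hne, w, hw⟩ => hne ?_
  exact (SimpleGraph.Walk.eq_of_length_eq_zero (by omega : w.length = 0)).symm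

theorem puncturedBall_finite_ncard {Δ : ℕ} (hΔ0 : 1 ≤ Δ)
    (hΔ : ∀ v, (G.neighborSet v).Finite ∧ (G.neighborSet v).ncard ≤ Δ) (k : ℕ) (e : V) :
    (puncturedBall G k e).Finite ∧ (puncturedBall G k e).ncard ≤ Δ ^ k := by
  classical
  have hpar : ∀ f, ∃ g, G.Reachable e f → f ≠ e → G.Adj f g ∧ G.dist e g + 1 = G.dist e f := by
    intro f
    by_cases h : G.Reachable e f ∧ f ≠ e
    · obtain ⟨g, h1, _, h2⟩ := exists_adj_dist_add_one h.1 h.2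
      exact ⟨g, fun _ _ => ⟨h1.symm, h2⟩⟩
    · exact ⟨f, fun h1 h2 => absurd ⟨h1, h2⟩ h⟩
  choose par hpar using hpar
  have step : ∀ k, (puncturedBall G k e).Finite → (puncturedBall G (k + 1) e).Finite ∧
      (puncturedBall G (k + 1) e).ncard ≤ Δ + (puncturedBall G k e).ncard * (Δ - 1) := by
    intro k hfin
    have hsub := puncturedBall_succ_subset (G := G) k e par fun f h1 h2 => (hpar f h1 h2).2
    have hfs : ∀ v, (G.neighborSet v \ {par v}).Finite := fun v => (hΔ v).1.subset Set.sdiff_subset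
    let T : Finset V := (hΔ e).1.toFinset ∪ hfin.toFinset.biUnion fun f => (hfs f).toFinset
    have hT : puncturedBall G (k + 1) e ⊆ T := by
      intro f hf
      rcases hsub hf with h | h
      · simp only [T, Finset.coe_union]
        exact Or.inl (by simpa using h)
      · simp only [T, Finset.coe_union]
        refine Or.inr ?_
        simpa using h
    refine ⟨(Finset.finite_toSet T).subset hT, ?_⟩
    calc (puncturedBall G (k + 1) e).ncard ≤ (T : Set V).ncard :=
          Set.ncard_le_ncard hT (Finset.finite_toSet T)
      _ = T.card := Set.ncard_coe_finset T
      _ ≤ _ := (Finset.card_union_le _ _).trans (add_le_add ?_ ?_)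
    · rw [← Set.ncard_eq_toFinset_card _ (hΔ e).1]
      exact (hΔ e).2
    · rw [Set.ncard_eq_toFinset_card _ hfin]
      refine Finset.card_biUnion_le_card_mul _ _ _ fun f hf => ?_
      rw [← Set.ncard_eq_toFinset_card _ (hfs f)]
      obtain ⟨hne, hr, _⟩ := mem_puncturedBall.1 (hfin.mem_toFinset.1 hf)
      rw [Set.ncard_sdiff_singleton_of_mem
        (show par f ∈ G.neighborSet f from (hpar f hr hne).1)]
      have := (hΔ f).2
      omega
  have main : ∀ k, (puncturedBall G (k + 1) e).Finite ∧
      (puncturedBall G (k + 1) e).ncard ≤ Δ ^ (k + 1) := by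
    intro k
    induction k with
    | zero =>
      have := step 0 (by simp [puncturedBall_zero])
      refine ⟨this.1, this.2.trans ?_⟩
      simp [puncturedBall_zero]
    | succ k ih =>
      have := step (k + 1) ih.1
      refine ⟨this.1, this.2.trans ?_⟩
      calc _ ≤ Δ + Δ ^ (k + 1) * (Δ - 1) := by gcongr; exact ih.2
        _ ≤ Δ ^ (k + 1) + Δ ^ (k + 1) * (Δ - 1) := by
          gcongr
          exact Nat.le_self_pow (by omega) Δ
        _ = Δ ^ (k + 1) * (1 + (Δ - 1)) := by ring
        _ = Δ ^ (k + 1 + 1) := by rw [Nat.add_sub_cancel' hΔ0, ← pow_succ]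
  cases k with
  | zero => simp [puncturedBall_zero]
  | succ k => exact main k

end Balls

/-! ### The line graph -/

section LineGraph

variable {V : Type*} {G : SimpleGraph V} {d : ℕ}

theorem lineGraph_adj {e f : G.edgeSet} :
    G.lineGraph.Adj e f ↔ e ≠ f ∧ ∃ v, v ∈ e.1 ∧ v ∈ f.1 := by
  rw [SimpleGraph.lineGraph_adj_iff_exists]

/-- Each of the two endpoints carries at most `d - 1` further edges. -/
theorem lineGraph_degree (hd : ∀ v, (G.neighborSet v).Finite ∧ (G.neighborSet v).ncard ≤ d)
    (e : G.edgeSet) :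
    (G.lineGraph.neighborSet e).Finite ∧ (G.lineGraph.neighborSet e).ncard ≤ 2 * d - 2 := by
  obtain ⟨⟨x, y⟩, he⟩ := e
  have hxy : G.Adj x y := he
  let S : Set (Sym2 V) := (fun v => s(x, v)) '' (G.neighborSet x \ {y}) ∪
    (fun v => s(y, v)) '' (G.neighborSet y \ {x})
  have hfin : ∀ v w, (G.neighborSet v \ {w}).Finite := fun v w => (hd v).1.subset Set.sdiff_subset
  have hS : S.Finite := ((hfin x y).image _).union ((hfin y x).image _)
  have hsub : Subtype.val '' (G.lineGraph.neighborSet ⟨s(x, y), he⟩) ⊆ S := by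
    rintro _ ⟨⟨f, hf⟩, hadj, rfl⟩
    obtain ⟨hne, v, hv, hvf⟩ := lineGraph_adj.1 hadj
    obtain ⟨z, rfl⟩ := Sym2.mem_iff_exists.1 hvf
    have hvz : G.Adj v z := hf
    rcases Sym2.mem_iff.1 hv with rfl | rfl
    · refine Or.inl ⟨z, ⟨hvz, ?_⟩, rfl⟩
      rintro rfl
      exact hne rfl
    · refine Or.inr ⟨z, ⟨hvz, ?_⟩, rfl⟩
      rintro rfl
      exact hne (Subtype.ext Sym2.eq_swap)
  refine ⟨(hS.subset hsub).of_finite_image Subtype.val_injective.injOn, ?_⟩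
  rw [← Set.ncard_image_of_injective _ Subtype.val_injective]
  refine (Set.ncard_le_ncard hsub hS).trans ((Set.ncard_union_le _ _).trans ?_)
  have h1 := Set.ncard_image_le (f := fun v => s(x, v)) (hfin x y)
  have h2 := Set.ncard_image_le (f := fun v => s(y, v)) (hfin y x)
  rw [Set.ncard_sdiff_singleton_of_mem (show y ∈ G.neighborSet x from hxy)] at h1
  rw [Set.ncard_sdiff_singleton_of_mem (show x ∈ G.neighborSet y from hxy.symm)] at h2
  have h3 := (hd x).2
  have h4 := (hd y).2
  omega

theorem exists_lineGraph_walk {u v : V} (w : G.Walk u v) :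
    ∀ {e f : G.edgeSet}, u ∈ e.1 → v ∈ f.1 →
      ∃ w' : G.lineGraph.Walk e f, w'.length ≤ w.length + 1 := by
  have base : ∀ {e f : G.edgeSet} {u : V}, u ∈ e.1 → u ∈ f.1 →
      ∃ w' : G.lineGraph.Walk e f, w'.length ≤ 1 := by
    intro e f u he hf
    by_cases h : e = f
    · subst h
      exact ⟨.nil, by simp⟩
    · exact ⟨.cons (lineGraph_adj.2 ⟨h, u, he, hf⟩) .nil, by simp⟩
  induction w with
  | nil => intro e f he hf; simpa using base he hf
  | @cons u x v hadj w ih =>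
    intro e f he hf
    obtain ⟨w1, h1⟩ := base (e := e) (f := ⟨s(u, x), hadj⟩) he (by simp)
    obtain ⟨w2, h2⟩ := ih (e := ⟨s(u, x), hadj⟩) (by simp) hf
    refine ⟨w1.append w2, ?_⟩
    rw [SimpleGraph.Walk.length_append, SimpleGraph.Walk.length_cons]
    omega

theorem dist_le_one_of_mem {e : G.edgeSet} {u v : V} (hu : u ∈ e.1) (hv : v ∈ e.1) :
    G.dist u v ≤ 1 := by
  by_cases h : u = v
  · simp [h]
  · have : G.Adj u v := by
      rw [← SimpleGraph.mem_edgeSet, ← (Sym2.mem_and_mem_iff h).1 ⟨hu, hv⟩]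
      exact e.2
    exact (SimpleGraph.dist_eq_one_iff_adj.2 this).le

theorem dist_le_of_lineGraph_walk (hG : G.Connected) {e f : G.edgeSet}
    (w : G.lineGraph.Walk e f) :
    ∀ {u v : V}, u ∈ e.1 → v ∈ f.1 → G.dist u v ≤ w.length + 1 := by
  induction w with
  | nil => intro u v hu hv; simpa using dist_le_one_of_mem hu hv
  | @cons e e' f hadj w ih =>
    intro u v hu hv
    obtain ⟨_, z, hz, hz'⟩ := lineGraph_adj.1 hadj
    have h1 := hG.dist_triangle (u := u) (v := z) (w := v)
    have h2 := dist_le_one_of_mem hu hz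
    have h3 := ih hz' hv
    rw [SimpleGraph.Walk.length_cons]
    omega

end LineGraph

/-! ### Words in the generators and the double covers of the Cayley graph -/

section Words

variable {α : Type*} {rels : Finset (FreeGroup α)}

/-- The group element represented by a letter. -/
def letterValue (rels : Finset (FreeGroup α)) (x : α × Bool) :
    PresentedGroup (rels : Set (FreeGroup α)) :=
  cond x.2 (PresentedGroup.of x.1) (PresentedGroup.of x.1)⁻¹

/-- The group element represented by a word. -/
def wordValue (rels : Finset (FreeGroup α)) (L : List (α × Bool)) :
    PresentedGroup (rels : Set (FreeGroup α)) :=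
  (L.map (letterValue rels)).prod

theorem wordValue_cons (x : α × Bool) (L : List (α × Bool)) :
    wordValue rels (x :: L) = letterValue rels x * wordValue rels L := by
  simp [wordValue]

theorem wordValue_append (L L' : List (α × Bool)) :
    wordValue rels (L ++ L') = wordValue rels L * wordValue rels L' := by
  simp [wordValue]

theorem presentedGroup_mk_eq_wordValue (L : List (α × Bool)) :
    PresentedGroup.mk (rels : Set (FreeGroup α)) (FreeGroup.mk L) = wordValue rels L := by
  have : PresentedGroup.mk (rels : Set (FreeGroup α)) =
      FreeGroup.lift (PresentedGroup.of : α → PresentedGroup (rels : Set (FreeGroup α))) := by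
    ext x
    simp [PresentedGroup.of]
  rw [this, FreeGroup.lift_mk]
  rfl

theorem wordValue_toWord_of_mem [DecidableEq α] {r : FreeGroup α} (hr : r ∈ rels) :
    wordValue rels r.toWord = 1 := by
  rw [← presentedGroup_mk_eq_wordValue, FreeGroup.mk_toWord]
  exact PresentedGroup.one_of_mem (by simpa using hr)

theorem exists_wordValue_eq (g : PresentedGroup (rels : Set (FreeGroup α))) :
    ∃ L, wordValue rels L = g := by
  classical
  obtain ⟨w, rfl⟩ := PresentedGroup.mk_surjective (rels : Set (FreeGroup α)) g
  exact ⟨w.toWord, by rw [← presentedGroup_mk_eq_wordValue, FreeGroup.mk_toWord]⟩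

theorem cayleyGraph_adj_mul_left {g u v : PresentedGroup (rels : Set (FreeGroup α))} :
    (cayleyGraph rels).Adj (g * u) (g * v) ↔ (cayleyGraph rels).Adj u v :=
  SimpleGraph.mulCayley_adj_mul_iff_right

/-- A generator may be trivial in the presented group; its letter then does not move. -/
theorem eq_or_adj_mul_letterValue (g : PresentedGroup (rels : Set (FreeGroup α)))
    (x : α × Bool) :
    g = g * letterValue rels x ∨ (cayleyGraph rels).Adj g (g * letterValue rels x) := by
  rw [or_iff_not_imp_left]
  intro h
  rw [cayleyGraph, SimpleGraph.mulCayley_adj]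
  refine ⟨h, ?_⟩
  obtain ⟨a, b⟩ := x
  cases b
  · exact Or.inr ⟨a, by simp [letterValue]⟩
  · exact Or.inl ⟨a, by simp [letterValue]⟩

theorem exists_letterValue_of_adj {u v : PresentedGroup (rels : Set (FreeGroup α))}
    (h : (cayleyGraph rels).Adj u v) :
    ∃ s, v = u * PresentedGroup.of s ∨ u = v * PresentedGroup.of s := by
  rw [cayleyGraph, SimpleGraph.mulCayley_adj] at h
  rcases h.2 with ⟨s, hs⟩ | ⟨s, hs⟩
  · exact ⟨s, Or.inl (by simp [hs])⟩
  · exact ⟨s, Or.inr (by simp [hs])⟩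

/-- The successive unordered pairs of vertices traversed by a word read from `g`. -/
def trace (rels : Finset (FreeGroup α)) (g : PresentedGroup (rels : Set (FreeGroup α))) :
    List (α × Bool) → List (Sym2 (PresentedGroup (rels : Set (FreeGroup α))))
  | [] => []
  | x :: L => s(g, g * letterValue rels x) :: trace rels (g * letterValue rels x) L

theorem exists_index_of_mem_trace {e : Sym2 (PresentedGroup (rels : Set (FreeGroup α)))}
    (L : List (α × Bool)) : ∀ {g}, e ∈ trace rels g L → ∃ i < L.length,
      e = s(g * wordValue rels (L.take i), g * wordValue rels (L.take (i + 1))) := by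
  induction L with
  | nil => intro g h; simp [trace] at h
  | cons x L ih =>
    intro g h
    rw [trace, List.mem_cons] at h
    rcases h with rfl | h
    · exact ⟨0, by simp, by simp [wordValue]⟩
    · obtain ⟨i, hi, he⟩ := ih h
      refine ⟨i + 1, by simpa using hi, ?_⟩
      rw [he, List.take_succ_cons, List.take_succ_cons, wordValue_cons, wordValue_cons, mul_assoc,
        mul_assoc]

theorem exists_walk_wordValue_take (g : PresentedGroup (rels : Set (FreeGroup α)))
    (L : List (α × Bool)) {i j : ℕ} (hij : i ≤ j) (hj : j ≤ L.length) :
    ∃ w : (cayleyGraph rels).Walk (g * wordValue rels (L.take i)) (g * wordValue rels (L.take j)),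
      w.length ≤ j - i := by
  induction j, hij using Nat.le_induction with
  | base => exact ⟨.nil, by simp⟩
  | succ j hij ih =>
    obtain ⟨w, hw⟩ := ih (by omega)
    have hstep : g * wordValue rels (L.take (j + 1)) =
        g * wordValue rels (L.take j) * letterValue rels (L[j]'(by omega)) := by
      rw [List.take_succ_eq_append_getElem (by omega), wordValue_append, ← mul_assoc]
      simp [wordValue]
    rcases eq_or_adj_mul_letterValue (g * wordValue rels (L.take j)) (L[j]'(by omega)) with h | h
    · rw [hstep, ← h]
      exact ⟨w, by omega⟩
    · rw [hstep]
      refine ⟨w.concat h, ?_⟩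
      rw [SimpleGraph.Walk.length_concat]
      omega

/-- Edges of a closed walk of length at most `t` are within distance `t / 2` in the line graph. -/
theorem mem_puncturedBall_of_mem_trace {g : PresentedGroup (rels : Set (FreeGroup α))}
    {L : List (α × Bool)} {t : ℕ} (hL : wordValue rels L = 1) (ht : L.length ≤ t)
    {e f : (cayleyGraph rels).edgeSet} (he : e.1 ∈ trace rels g L) (hf : f.1 ∈ trace rels g L)
    (hne : f ≠ e) : f ∈ puncturedBall (cayleyGraph rels).lineGraph (t / 2) e := by
  obtain ⟨i, hi, hei⟩ := exists_index_of_mem_trace L he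
  obtain ⟨j, hj, hfj⟩ := exists_index_of_mem_trace L hf
  wlog hij : i < j generalizing e f i j
  · have hne' : i ≠ j := fun h => hne (Subtype.ext (by rw [hei, hfj, h]))
    exact mem_puncturedBall_comm.1 (this hf he hne.symm j hj hfj i hi hei (by omega))
  obtain ⟨w, hw⟩ : ∃ w : (cayleyGraph rels).lineGraph.Walk e f, w.length ≤ j - i := by
    obtain ⟨w, hw⟩ := exists_walk_wordValue_take g L (i := i + 1) (j := j) hij hj.le
    obtain ⟨w', hw'⟩ := exists_lineGraph_walk w (e := e) (f := f) (by simp [hei]) (by simp [hfj])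
    exact ⟨w', by omega⟩
  -- The complementary arc, running through the base point of the closed walk. The two arc lengths
  -- sum to at most `t`, so one of them is at most `t / 2`.
  obtain ⟨w', hw'⟩ : ∃ w : (cayleyGraph rels).lineGraph.Walk f e,
      w.length ≤ L.length - (j - i) := by
    obtain ⟨w1, hw1⟩ := exists_walk_wordValue_take g L (i := j + 1) (j := L.length) hj le_rfl
    obtain ⟨w2, hw2⟩ := exists_walk_wordValue_take g L (i := 0) (j := i) (by omega) hi.le
    have h0 : g * wordValue rels (L.take L.length) = g * wordValue rels (L.take 0) := by
      rw [List.take_length, hL]; simp [wordValue]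
    obtain ⟨w', hw'⟩ := exists_lineGraph_walk ((w1.copy rfl h0).append w2) (e := f) (f := e)
      (by simp [hfj]) (by simp [hei])
    rw [SimpleGraph.Walk.length_append, SimpleGraph.Walk.length_copy] at hw'
    exact ⟨w', by omega⟩
  rcases le_or_gt (j - i) (t / 2) with h | h
  · exact ⟨hne, w, hw.trans h⟩
  · exact ⟨hne, w'.reverse, by rw [SimpleGraph.Walk.length_reverse]; omega⟩

/-- The indicator function of a set with values in `ZMod 2`. -/
def ind {X : Type*} (A : Set X) : X → ZMod 2 := A.indicator 1

theorem ind_of_mem {X : Type*} {A : Set X} {x : X} (h : x ∈ A) : ind A x = 1 := by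
  simp [ind, h]

theorem ind_of_notMem {X : Type*} {A : Set X} {x : X} (h : x ∉ A) : ind A x = 0 := by
  simp [ind, h]

variable (A : Set (Sym2 (PresentedGroup (rels : Set (FreeGroup α)))))

/-- The action of a generator on the double cover of the Cayley graph in which the two sheets are
exchanged along the edges in `A`. -/
def coverPerm (s : α) :
    Equiv.Perm (PresentedGroup (rels : Set (FreeGroup α)) × ZMod 2) where
  toFun x := (x.1 * PresentedGroup.of s, x.2 + ind A s(x.1, x.1 * PresentedGroup.of s))
  invFun x := (x.1 * (PresentedGroup.of s)⁻¹, x.2 + ind A s(x.1, x.1 * (PresentedGroup.of s)⁻¹))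
  left_inv x := by
    ext
    · simp
    · simp only [mul_inv_cancel_right]
      rw [Sym2.eq_swap, add_assoc, CharTwo.add_self_eq_zero, add_zero]
  right_inv x := by
    ext
    · simp
    · simp only [inv_mul_cancel_right]
      rw [Sym2.eq_swap, add_assoc, CharTwo.add_self_eq_zero, add_zero]

/-- The right action of the free group on the double cover. -/
def coverHom : FreeGroup α →*
    (Equiv.Perm (PresentedGroup (rels : Set (FreeGroup α)) × ZMod 2))ᵐᵒᵖ :=
  FreeGroup.lift fun s => MulOpposite.op (coverPerm A s)

/-- The sheet changes by the parity of the crossings of `A`. The opposite group appears because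
words act from the right. -/
theorem coverHom_mk (L : List (α × Bool)) : ∀ g ε,
    (coverHom A (FreeGroup.mk L)).unop (g, ε) =
      (g * wordValue rels L, ε + ((trace rels g L).map (ind A)).sum) := by
  rw [coverHom, FreeGroup.lift_mk]
  induction L with
  | nil => intro g ε; simp [wordValue, trace]
  | cons x L ih =>
    intro g ε
    rw [List.map_cons, List.prod_cons, MulOpposite.unop_mul, Equiv.Perm.mul_apply]
    have hx : (cond x.2 (MulOpposite.op (coverPerm A x.1))
        (MulOpposite.op (coverPerm A x.1))⁻¹).unop (g, ε) =
          (g * letterValue rels x, ε + ind A s(g, g * letterValue rels x)) := by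
      obtain ⟨a, b⟩ := x
      cases b <;> rfl
    rw [hx, ih, wordValue_cons, trace, List.map_cons, List.sum_cons, mul_assoc, add_assoc]

/-- If every relator meets `A` an even number of times, then `A` is the edge boundary of a set of
vertices. -/
theorem exists_potential [DecidableEq α]
    (hA : ∀ r ∈ rels, ∀ g, ((trace rels g r.toWord).map (ind A)).sum = 0) :
    ∃ φ : PresentedGroup (rels : Set (FreeGroup α)) → ZMod 2,
      ∀ u v, (cayleyGraph rels).Adj u v → φ v = φ u + ind A s(u, v) := by
  -- Evenness says that relators act trivially on the cover, so the action descends to the presented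
  -- group. The potential of `g` is then the sheet to which `g` carries `(1, 0)`.
  have hrel : ∀ r ∈ (rels : Set (FreeGroup α)),
      FreeGroup.lift (fun s => MulOpposite.op (coverPerm A s)) r = 1 := by
    intro r hr
    have hr' : r ∈ rels := by simpa using hr
    have := coverHom_mk A r.toWord
    rw [FreeGroup.mk_toWord] at this
    refine MulOpposite.unop_injective (Equiv.ext fun ⟨g, ε⟩ => ?_)
    have h2 := this g ε
    rw [hA r hr', wordValue_toWord_of_mem hr', mul_one, add_zero] at h2
    exact h2
  let T : PresentedGroup (rels : Set (FreeGroup α)) →*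
      (Equiv.Perm (PresentedGroup (rels : Set (FreeGroup α)) × ZMod 2))ᵐᵒᵖ :=
    PresentedGroup.toGroup hrel
  have hT1 : ∀ g, ((T g).unop (1, 0)).1 = g := by
    intro g
    obtain ⟨w, rfl⟩ := PresentedGroup.mk_surjective (rels : Set (FreeGroup α)) g
    have h1 : T (PresentedGroup.mk _ w) = coverHom A w := rfl
    rw [h1]
    conv_lhs => rw [← FreeGroup.mk_toWord (x := w)]
    rw [coverHom_mk, ← presentedGroup_mk_eq_wordValue, FreeGroup.mk_toWord, one_mul]
  have hT2 : ∀ g s, ((T (g * PresentedGroup.of s)).unop (1, 0)).2 =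
      ((T g).unop (1, 0)).2 + ind A s(g, g * PresentedGroup.of s) := by
    intro g s
    have h1 : T (PresentedGroup.of s) = MulOpposite.op (coverPerm A s) :=
      PresentedGroup.toGroup.of hrel
    rw [map_mul, h1, MulOpposite.unop_mul, MulOpposite.unop_op, Equiv.Perm.mul_apply]
    conv_rhs => rw [← hT1 g]
    rw [hT1 g]
    change _ + ind A s(((T g).unop (1, 0)).1, ((T g).unop (1, 0)).1 * _) = _
    rw [hT1 g]
  refine ⟨fun g => ((T g).unop (1, 0)).2, fun u v huv => ?_⟩
  obtain ⟨s, rfl | rfl⟩ := exists_letterValue_of_adj huv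
  · exact hT2 u s
  · beta_reduce
    rw [hT2 v s, Sym2.eq_swap, add_assoc, CharTwo.add_self_eq_zero, add_zero]

end Words

/-! ### Connectivity of minimal cuts -/

section Cuts

/-- A set of vertices is tied together if every function that is constant along the edges inside it
is constant. -/
def Tied {V : Type*} (G : SimpleGraph V) (K : Set V) : Prop :=
  ∀ φ : V → ZMod 2, (∀ u ∈ K, ∀ v ∈ K, G.Adj u v → φ u = φ v) → ∀ u ∈ K, ∀ v ∈ K, φ u = φ v

/-- The edge boundary of a set of vertices. -/
def edgeBoundary {V : Type*} (G : SimpleGraph V) (K : Set V) : Set G.edgeSet :=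
  {e | ∃ u v, u ∈ K ∧ v ∉ K ∧ e.1 = s(u, v)}

variable {α : Type*} {rels : Finset (FreeGroup α)}

theorem ind_edge_eq_add (K : Set (PresentedGroup (rels : Set (FreeGroup α))))
    (B : Set (Sym2 (PresentedGroup (rels : Set (FreeGroup α)))))
    (hB : ∀ e, e ∈ B ↔ ∃ u v, u ∈ K ∧ v ∉ K ∧ e = s(u, v)) (u v) :
    ind B s(u, v) = ind K u + ind K v := by
  by_cases hu : u ∈ K <;> by_cases hv : v ∈ K
  · rw [ind_of_mem hu, ind_of_mem hv, ind_of_notMem]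
    · decide
    · rw [hB]
      rintro ⟨a, b, ha, hb, h⟩
      rcases Sym2.eq_iff.1 h with ⟨rfl, rfl⟩ | ⟨rfl, rfl⟩ <;> contradiction
  · rw [ind_of_mem hu, ind_of_notMem hv, ind_of_mem, add_zero]
    exact (hB _).2 ⟨u, v, hu, hv, rfl⟩
  · rw [ind_of_notMem hu, ind_of_mem hv, ind_of_mem, zero_add]
    exact (hB _).2 ⟨v, u, hv, hu, Sym2.eq_swap⟩
  · rw [ind_of_notMem hu, ind_of_notMem hv, ind_of_notMem, add_zero]
    rw [hB]
    rintro ⟨a, b, ha, hb, h⟩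
    rcases Sym2.eq_iff.1 h with ⟨rfl, rfl⟩ | ⟨rfl, rfl⟩ <;> contradiction

/-- The cut is the mod 2 coboundary of the indicator of `K`, so the sum telescopes; on closed walks
it vanishes. -/
theorem sum_ind_trace (K : Set (PresentedGroup (rels : Set (FreeGroup α))))
    (B : Set (Sym2 (PresentedGroup (rels : Set (FreeGroup α)))))
    (hB : ∀ e, e ∈ B ↔ ∃ u v, u ∈ K ∧ v ∉ K ∧ e = s(u, v)) (L : List (α × Bool)) :
    ∀ g, ((trace rels g L).map (ind B)).sum = ind K g + ind K (g * wordValue rels L) := by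
  induction L with
  | nil => intro g; simp [trace, wordValue, CharTwo.add_self_eq_zero]
  | cons x L ih =>
    intro g
    rw [trace, List.map_cons, List.sum_cons, ih, ind_edge_eq_add K B hB, wordValue_cons,
      ← mul_assoc]
    rw [add_assoc, ← add_assoc (ind K (g * letterValue rels x)), CharTwo.add_self_eq_zero,
      zero_add]

/-- The edge boundary of a tied set with tied complement is connected with respect to distance
`t / 2` in the line graph, `t` being the maximal length of a relator. -/
theorem edgeBoundary_connected [DecidableEq α]
    {K : Set (PresentedGroup (rels : Set (FreeGroup α)))}
    (hK : Tied (cayleyGraph rels) K) (hK' : Tied (cayleyGraph rels) Kᶜ)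
    {A : Set (cayleyGraph rels).edgeSet} (hA : A ⊆ edgeBoundary (cayleyGraph rels) K)
    (hne : A.Nonempty)
    (hcl : ∀ a ∈ A, ∀ b ∈ edgeBoundary (cayleyGraph rels) K,
      b ∈ puncturedBall (cayleyGraph rels).lineGraph (maxRelatorLength rels / 2) a → b ∈ A) :
    A = edgeBoundary (cayleyGraph rels) K := by
  let A' : Set (Sym2 (PresentedGroup (rels : Set (FreeGroup α)))) := Subtype.val '' A
  let B : Set (Sym2 (PresentedGroup (rels : Set (FreeGroup α)))) :=
    {e | ∃ u v, u ∈ K ∧ v ∉ K ∧ e = s(u, v)}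
  have hB : ∀ e, e ∈ B ↔ ∃ u v, u ∈ K ∧ v ∉ K ∧ e = s(u, v) := fun e => Iff.rfl
  have hAB : A' ⊆ B := by
    rintro _ ⟨e, he, rfl⟩
    exact hA he
  have heven : ∀ r ∈ rels, ∀ g, ((trace rels g r.toWord).map (ind A')).sum = 0 := by
    intro r hr g
    have hval := wordValue_toWord_of_mem hr
    have hlen : r.toWord.length ≤ maxRelatorLength rels := Finset.le_sup (f := FreeGroup.norm) hr
    by_cases hex : ∃ e ∈ trace rels g r.toWord, e ∈ A'
    · obtain ⟨_, he, e, heA, rfl⟩ := hex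
      -- Once the relator uses one edge of `A`, every cut edge on it is within distance `t / 2` of
      -- that edge, hence in `A`. The relator therefore meets `A` as often as the whole cut, which
      -- is an even number of times.
      have hmap : (trace rels g r.toWord).map (ind A') = (trace rels g r.toWord).map (ind B) := by
        refine List.map_congr_left fun f hf => ?_
        by_cases hfB : f ∈ B
        · rw [ind_of_mem hfB, ind_of_mem]
          have hfE : f ∈ (cayleyGraph rels).edgeSet := by
            obtain ⟨i, hi, hfi⟩ := exists_index_of_mem_trace _ hf
            obtain ⟨w, hw⟩ := exists_walk_wordValue_take g r.toWord (Nat.le_succ i) hi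
            obtain ⟨u, v, hu, hv, rfl⟩ := hfB
            have huv : u ≠ v := fun h => hv (h ▸ hu)
            rw [SimpleGraph.mem_edgeSet]
            have key : ∀ a b, (∃ w : (cayleyGraph rels).Walk a b, w.length ≤ 1) → a ≠ b →
                (cayleyGraph rels).Adj a b := by
              rintro a b ⟨w, hw⟩ hab
              cases w with
              | nil => exact absurd rfl hab
              | cons h w =>
                rw [SimpleGraph.Walk.length_cons] at hw
                exact (SimpleGraph.Walk.eq_of_length_eq_zero (by omega : w.length = 0)) ▸ h
            have hw' := key _ _ ⟨w, by omega⟩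
            rcases Sym2.eq_iff.1 hfi with ⟨rfl, rfl⟩ | ⟨rfl, rfl⟩
            · exact hw' huv
            · exact (hw' huv.symm).symm
          refine ⟨⟨f, hfE⟩, ?_, rfl⟩
          by_cases hef : (⟨f, hfE⟩ : (cayleyGraph rels).edgeSet) = e
          · rwa [hef]
          · exact hcl e heA _ hfB (mem_puncturedBall_of_mem_trace hval hlen he hf hef)
        · rw [ind_of_notMem hfB, ind_of_notMem fun h => hfB (hAB h)]
      rw [hmap, sum_ind_trace K B hB, hval, mul_one, CharTwo.add_self_eq_zero]
    · refine List.sum_eq_zero fun x hx => ?_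
      obtain ⟨e, he, rfl⟩ := List.mem_map.1 hx
      exact ind_of_notMem fun h => hex ⟨e, he, h⟩
  obtain ⟨φ, hφ⟩ := exists_potential A' heven
  have hin : ∀ u ∈ K, ∀ v ∈ K, φ u = φ v := hK φ fun u hu v hv h => by
    rw [hφ u v h, ind_of_notMem, add_zero]
    intro hmem
    obtain ⟨a, b, ha, hb, he⟩ := hAB hmem
    rcases Sym2.eq_iff.1 he with ⟨rfl, rfl⟩ | ⟨rfl, rfl⟩ <;> contradiction
  have hout : ∀ u ∈ Kᶜ, ∀ v ∈ Kᶜ, φ u = φ v := hK' φ fun u hu v hv h => by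
    rw [hφ u v h, ind_of_notMem, add_zero]
    intro hmem
    obtain ⟨a, b, ha, hb, he⟩ := hAB hmem
    rcases Sym2.eq_iff.1 he with ⟨rfl, rfl⟩ | ⟨rfl, rfl⟩ <;> contradiction
  -- `φ` has one value on `K` and one on its complement. They differ, as `A` has an edge, so `φ`
  -- jumps across every boundary edge and all of these lie in `A`.
  refine Set.Subset.antisymm hA ?_
  rintro ⟨f, hf⟩ ⟨u, v, hu, hv, rfl⟩
  obtain ⟨⟨e, he⟩, heA⟩ := hne
  obtain ⟨a, b, ha, hb, rfl⟩ := hA heA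
  have h1 := hφ a b he
  rw [ind_of_mem (show s(a, b) ∈ A' from ⟨_, heA, rfl⟩), hin a ha u hu, hout b hb v hv, hφ u v hf] at h1
  by_contra hfA
  rw [ind_of_notMem] at h1
  · simp at h1
  · rintro ⟨e', he', heq⟩
    exact hfA (by convert he'; exact heq.symm)

end Cuts

/-! ### One-ended graphs -/

section Ends

universe u

variable {V : Type u} {G : SimpleGraph V}

open CategoryTheory in
-- Infinite components are those in the eventual range of the inverse system of components. This
-- system is Mittag-Leffler, so each of them is the value at `K` of some end, and there is at most
-- one end.
theorem eq_of_infinite_componentCompl [G.LocallyFinite] (hG : G.Preconnected)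
    [Subsingleton G.end] {K : Finset V} {C D : G.ComponentCompl K} (hC : C.supp.Infinite)
    (hD : D.supp.Infinite) : C = D := by
  have : Fact G.Preconnected := ⟨hG⟩
  have : Infinite V := Set.infinite_univ_iff.1 (hC.mono (Set.subset_univ _))
  let F := G.componentComplFunctor
  have hfin : ∀ j, Finite (F.obj j) := fun j => G.componentCompl_finite j.unop
  have hne : ∀ j, Nonempty (F.obj j) := fun j => G.componentCompl_nonempty_of_infinite j.unop
  have hML : F.IsMittagLeffler :=
    F.isMittagLeffler_of_exists_finite_range fun j => ⟨j, 𝟙 j, Set.toFinite _⟩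
  have hne' : ∀ j, Nonempty (F.toEventualRanges.obj j) := F.toEventualRanges_nonempty hML
  have hsurj := F.toEventualRanges.eval_section_surjective_of_surjective
    (F.surjective_toEventualRanges hML) (Opposite.op K)
  obtain ⟨s, hs⟩ := hsurj ⟨C, (SimpleGraph.infinite_iff_in_eventualRange G
    (K := Opposite.op K) C).1 hC⟩
  obtain ⟨s', hs'⟩ := hsurj ⟨D, (SimpleGraph.infinite_iff_in_eventualRange G
    (K := Opposite.op K) D).1 hD⟩
  have heq : F.toEventualRangesSectionsEquiv s = F.toEventualRangesSectionsEquiv s' :=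
    Subsingleton.elim (α := G.end) _ _
  rw [F.toEventualRangesSectionsEquiv.injective heq, hs'] at hs
  exact (congrArg Subtype.val hs).symm

theorem exists_infinite_componentCompl (h : Nonempty G.end) (K : Finset V) :
    ∃ C : G.ComponentCompl K, C.supp.Infinite := by
  obtain ⟨e⟩ := h
  refine ⟨e.1 (Opposite.op K), SimpleGraph.ComponentCompl.infinite_iff_in_all_ranges _ |>.2
    fun L hL => ⟨e.1 (Opposite.op L), e.2 (CategoryTheory.opHomOfLE hL)⟩⟩

theorem tied_componentCompl {K : Set V} (C : G.ComponentCompl K) : Tied G C.supp := by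
  intro φ hφ u hu v hv
  obtain ⟨hu', hu⟩ := hu
  obtain ⟨hv', hv⟩ := hv
  have key : ∀ x y : (Kᶜ : Set V), (G.induce Kᶜ).Walk x y →
      (G.induce Kᶜ).connectedComponentMk x = C → φ x = φ y := by
    intro x y w
    induction w with
    | nil => intro _; rfl
    | @cons x z y h w ih =>
      intro hx
      have hz : (G.induce Kᶜ).connectedComponentMk z = C := by
        rw [← hx]
        exact SimpleGraph.ConnectedComponent.sound h.symm.reachable
      rw [← ih hz]
      exact hφ x ⟨x.2, hx⟩ z ⟨z.2, hz⟩ h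
  have hreach : (G.induce Kᶜ).Reachable ⟨u, hu'⟩ ⟨v, hv'⟩ :=
    SimpleGraph.ConnectedComponent.exact (hu.trans hv.symm)
  exact hreach.elim fun w => key _ _ w hu

/-- In a one-ended graph, filling the holes of a finite tied set makes the complement tied. -/
theorem exists_tied_hull [G.LocallyFinite] (hG : G.Preconnected) (h1 : OneEnded G) {C : Set V}
    (hC : C.Finite) (hne : C.Nonempty) (hCt : Tied G C) :
    ∃ K : Set V, C ⊆ K ∧ K.Finite ∧ Tied G K ∧ Tied G Kᶜ ∧
      ∀ u ∈ K, ∀ v ∉ K, G.Adj u v → u ∈ C := by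
  obtain ⟨hsub, hnon⟩ := Nat.card_eq_one_iff_unique.1 h1
  have : Fact G.Preconnected := ⟨hG⟩
  obtain ⟨S, rfl⟩ : ∃ S : Finset V, C = S := ⟨hC.toFinset, by simp⟩
  obtain ⟨D, hD⟩ := exists_infinite_componentCompl hnon S
  have hcov : ∀ v, v ∈ S ∨ ∃ D' : G.ComponentCompl S, v ∈ D'.supp := fun v => by
    by_cases hv : v ∈ S
    · exact Or.inl hv
    · exact Or.inr ⟨G.componentComplMk hv, SimpleGraph.componentComplMk_mem G hv⟩
  have hdisj : ∀ {D₁ D₂ : G.ComponentCompl S} {v}, v ∈ D₁.supp → v ∈ D₂.supp → D₁ = D₂ := by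
    rintro D₁ D₂ v ⟨h, h1⟩ ⟨_, h2⟩
    exact h1.symm.trans h2
  have hSD : ∀ v ∈ S, v ∉ D.supp := fun v hv h => D.notMem_of_mem h hv
  -- `D` is the only infinite component left by `S`; its complement is `S` with the finitely many
  -- finite components filled in.
  refine ⟨D.suppᶜ, hSD, ?_, ?_, ?_, ?_⟩
  · have hfin : (⋃ D' ∈ {D' : G.ComponentCompl S | D' ≠ D}, D'.supp).Finite := by
      refine Set.Finite.biUnion (Set.toFinite _) fun D' hD' => ?_
      by_contra hinf
      exact hD' (eq_of_infinite_componentCompl hG hinf hD)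
    refine (S.finite_toSet.union hfin).subset fun v hv => ?_
    rcases hcov v with h | ⟨D', h⟩
    · exact Or.inl h
    · exact Or.inr (Set.mem_biUnion (x := D') (fun hDD => hv (hDD ▸ h)) h)
  · intro φ hφ
    obtain ⟨c, hc⟩ := hne
    have hconst : ∀ u ∈ D.suppᶜ, φ u = φ c := by
      intro u hu
      have hS : ∀ u ∈ S, φ u = φ c := fun u hu =>
        hCt φ (fun a ha b hb => hφ a (hSD a ha) b (hSD b hb)) u hu c hc
      rcases hcov u with h | ⟨D', h⟩
      · exact hS u h
      · have hDD : D' ≠ D := fun hDD => hu (hDD ▸ h)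
        obtain ⟨⟨x, y⟩, hx, hy, hxy⟩ := D'.exists_adj_boundary_pair hG ⟨c, hc⟩
        have hD'D : ∀ a ∈ D'.supp, a ∈ D.suppᶜ := fun a ha ha' => hDD (hdisj ha ha')
        rw [tied_componentCompl D' φ
          (fun a ha b hb => hφ a (hD'D a ha) b (hD'D b hb)) u h x hx,
          hφ x (hD'D x hx) y (hSD y hy) hxy]
        exact hS y hy
    exact fun u hu v hv => (hconst u hu).trans (hconst v hv).symm
  · rw [compl_compl]
    exact tied_componentCompl D
  · intro u hu v hv huv
    by_contra huS
    exact hu (D.mem_of_adj v u (not_not.1 hv) huS huv.symm)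

theorem OneEnded.infinite (h1 : OneEnded G) : Infinite V := by
  obtain ⟨_, hnon⟩ := Nat.card_eq_one_iff_unique.1 h1
  obtain ⟨D, hD⟩ := exists_infinite_componentCompl hnon ∅
  exact Set.infinite_univ_iff.1 (hD.mono (Set.subset_univ _))

end Ends

/-! ### Long geodesics -/

section Geodesics

variable {V : Type*} {G : SimpleGraph V}

theorem exists_dist_ge [Infinite V] (hG : G.Connected) (hlf : ∀ v, (G.neighborSet v).Finite)
    (o : V) (n : ℕ) : ∃ v, n ≤ G.dist o v := by
  by_contra! hlt
  have hball : ∀ n, {v | G.dist o v ≤ n}.Finite := by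
    intro n
    induction n with
    | zero =>
      refine (Set.finite_singleton o).subset fun v hv => ?_
      exact ((hG.dist_eq_zero_iff).1 (Nat.le_zero.1 hv)).symm
    | succ n ih =>
      refine (ih.union (ih.biUnion fun v _ => hlf v)).subset fun v hv => ?_
      by_cases hvo : v = o
      · exact Or.inl (by simp [hvo])
      · obtain ⟨g, hadj, _, hg⟩ := exists_adj_dist_add_one (hG o v) hvo
        exact Or.inr (Set.mem_biUnion (x := g)
          (by simp only [Set.mem_ofPred_eq] at hv ⊢; omega) hadj)
  exact Set.infinite_univ ((hball n).subset fun v _ => (hlt v).le)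

theorem exists_geodesic [Infinite V] (hG : G.Connected) (hlf : ∀ v, (G.neighborSet v).Finite)
    (o : V) (n : ℕ) : ∃ x : ℕ → V, (∀ i < n, G.Adj (x i) (x (i + 1))) ∧
      ∀ i j, i ≤ j → j ≤ n → j ≤ i + G.dist (x i) (x j) := by
  obtain ⟨v, hv⟩ := exists_dist_ge hG hlf o n
  obtain ⟨w, hw⟩ := (hG o v).exists_walk_length_eq_dist
  refine ⟨w.getVert, fun i hi => w.adj_getVert_succ (by omega), fun i j hij hj => ?_⟩
  have h1 := SimpleGraph.dist_le (w.take i)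
  have h2 := SimpleGraph.dist_le (w.drop j)
  have h3 := hG.dist_triangle (u := o) (v := w.getVert i) (w := v)
  have h4 := hG.dist_triangle (u := w.getVert i) (v := w.getVert j) (w := v)
  rw [SimpleGraph.Walk.take_length] at h1
  rw [SimpleGraph.Walk.drop_length] at h2
  omega

end Geodesics

/-! ### Basic properties of Cayley graphs -/

section Cayley

variable {α : Type*} {rels : Finset (FreeGroup α)}

theorem cayleyGraph_connected : (cayleyGraph rels).Connected := by
  rw [SimpleGraph.connected_iff]
  have h1 : ∀ g, (cayleyGraph rels).Reachable 1 g := by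
    intro g
    obtain ⟨L, rfl⟩ := exists_wordValue_eq g
    obtain ⟨w, _⟩ := exists_walk_wordValue_take (rels := rels) 1 L (Nat.zero_le L.length) le_rfl
    have h0 : (1 : PresentedGroup (rels : Set (FreeGroup α))) * wordValue rels (L.take 0) = 1 := by
      simp [wordValue]
    have h1 : (1 : PresentedGroup (rels : Set (FreeGroup α))) *
        wordValue rels (L.take L.length) = wordValue rels L := by simp
    exact ⟨w.copy h0 h1⟩
  exact ⟨fun u v => (h1 u).symm.trans (h1 v), ⟨1⟩⟩

theorem cayleyGraph_neighborSet_finite [Finite α]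
    (v : PresentedGroup (rels : Set (FreeGroup α))) : ((cayleyGraph rels).neighborSet v).Finite := by
  refine ((Set.finite_range fun s : α => v * PresentedGroup.of s).union
    (Set.finite_range fun s : α => v * (PresentedGroup.of s)⁻¹)).subset fun u hu => ?_
  obtain ⟨s, h | h⟩ := exists_letterValue_of_adj hu
  · exact Or.inl ⟨s, h.symm⟩
  · exact Or.inr ⟨s, by simp [h]⟩

theorem cayleyGraph_neighborSet_ncard (v : PresentedGroup (rels : Set (FreeGroup α))) :
    ((cayleyGraph rels).neighborSet v).ncard = cayleyDegree rels := by
  have : (cayleyGraph rels).neighborSet v = (v * ·) '' (cayleyGraph rels).neighborSet 1 := by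
    ext u
    constructor
    · intro h
      refine ⟨v⁻¹ * u, ?_, by simp⟩
      have := cayleyGraph_adj_mul_left (rels := rels) (g := v) (u := 1) (v := v⁻¹ * u)
      rw [mul_one, mul_inv_cancel_left] at this
      exact this.1 h
    · rintro ⟨w, hw, rfl⟩
      have := cayleyGraph_adj_mul_left (rels := rels) (g := v) (u := 1) (v := w)
      rw [mul_one] at this
      exact this.2 hw
  rw [this, Set.ncard_image_of_injective _ (mul_right_injective v), cayleyDegree]

theorem cayleyGraph_dist_mul_left (g u v : PresentedGroup (rels : Set (FreeGroup α))) :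
    (cayleyGraph rels).dist (g * u) (g * v) = (cayleyGraph rels).dist u v := by
  have key : ∀ g u v : PresentedGroup (rels : Set (FreeGroup α)),
      (cayleyGraph rels).dist (g * u) (g * v) ≤ (cayleyGraph rels).dist u v := by
    intro g u v
    obtain ⟨w, hw⟩ := (cayleyGraph_connected (rels := rels) u v).exists_walk_length_eq_dist
    let f : cayleyGraph rels →g cayleyGraph rels :=
      { toFun := fun x => g * x
        map_rel' := fun h => cayleyGraph_adj_mul_left.2 h }
    have := SimpleGraph.dist_le (w.map f)
    rwa [SimpleGraph.Walk.length_map, hw] at this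
  refine le_antisymm (key g u v) ?_
  simpa using key g⁻¹ (g * u) (g * v)

theorem countable_presentedGroup [Finite α] :
    Countable (PresentedGroup (rels : Set (FreeGroup α))) :=
  Function.Surjective.countable (f := wordValue rels) exists_wordValue_eq

/-- Through every vertex of an infinite Cayley graph there are two-sided geodesics of every
length. -/
theorem exists_two_sided_geodesic [Finite α]
    [Infinite (PresentedGroup (rels : Set (FreeGroup α)))]
    (o : PresentedGroup (rels : Set (FreeGroup α))) (n : ℕ) :
    ∃ y z : ℕ → PresentedGroup (rels : Set (FreeGroup α)), y 0 = o ∧ z 0 = o ∧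
      (∀ i < n, (cayleyGraph rels).Adj (y i) (y (i + 1))) ∧
      (∀ i < n, (cayleyGraph rels).Adj (z i) (z (i + 1))) ∧
      ∀ i ≤ n, ∀ j ≤ n, i + j ≤ (cayleyGraph rels).dist (z i) (y j) := by
  obtain ⟨x, hadj, hdist⟩ := exists_geodesic (cayleyGraph_connected (rels := rels))
    cayleyGraph_neighborSet_finite 1 (n + n)
  -- Translates the midpoint of a geodesic of length `2n` to `o`.
  let g := o * (x n)⁻¹
  refine ⟨fun i => g * x (n + i), fun i => g * x (n - i), by simp [g], by simp [g],
    fun i hi => cayleyGraph_adj_mul_left.2 (hadj _ (by omega)), fun i hi => ?_, fun i hi j hj => ?_⟩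
  · have := hadj (n - (i + 1)) (by omega)
    rw [show n - (i + 1) + 1 = n - i by omega] at this
    exact cayleyGraph_adj_mul_left.2 this.symm
  · rw [cayleyGraph_dist_mul_left]
    have := hdist (n - i) (n + j) (by omega) (by omega)
    omega

theorem exists_exit {V : Type*} (y : ℕ → V) {K : Set V} (h0 : y 0 ∈ K) :
    ∀ n, y n ∉ K → ∃ j < n, y j ∈ K ∧ y (j + 1) ∉ K := by
  intro n
  induction n with
  | zero => exact fun h => absurd h0 h
  | succ n ih =>
    intro hn
    by_cases h : y n ∈ K
    · exact ⟨n, Nat.lt_succ_self n, h, hn⟩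
    · obtain ⟨j, hj, h1⟩ := ih h
      exact ⟨j, by omega, h1⟩

/-- Both arms start in `K` and end at distance at least `n` from `o`, outside `K`. -/
theorem exists_crossings {o : PresentedGroup (rels : Set (FreeGroup α))} {n : ℕ}
    {y z : ℕ → PresentedGroup (rels : Set (FreeGroup α))} (hy0 : y 0 = o) (hz0 : z 0 = o)
    (hyz : ∀ i ≤ n, ∀ j ≤ n, i + j ≤ (cayleyGraph rels).dist (z i) (y j))
    {K : Set (PresentedGroup (rels : Set (FreeGroup α)))} (ho : o ∈ K)
    (hK : ∀ v ∈ K, (cayleyGraph rels).dist o v < n) :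
    (∃ j < n, y j ∈ K ∧ y (j + 1) ∉ K) ∧ ∃ i < n, z i ∈ K ∧ z (i + 1) ∉ K := by
  refine ⟨exists_exit y (hy0 ▸ ho) n fun h => ?_, exists_exit z (hz0 ▸ ho) n fun h => ?_⟩
  · have h1 := hK _ h
    have h2 := hyz 0 (Nat.zero_le _) n le_rfl
    rw [hz0] at h2
    omega
  · have h1 := hK _ h
    have h2 := hyz n le_rfl 0 (Nat.zero_le _)
    rw [hy0, SimpleGraph.dist_comm] at h2
    omega

theorem exists_dist_lt {V : Type*} (G : SimpleGraph V) (o : V) {K : Set V} (hK : K.Finite) :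
    ∃ n, ∀ v ∈ K, G.dist o v < n := by
  obtain ⟨n, hn⟩ := (hK.image (G.dist o)).bddAbove
  exact ⟨n + 1, fun v hv => Nat.lt_succ_of_le (hn ⟨v, hv, rfl⟩)⟩

theorem two_le_cayleyDegree [Finite α] [Infinite (PresentedGroup (rels : Set (FreeGroup α)))] :
    2 ≤ cayleyDegree rels := by
  obtain ⟨y, z, hy0, hz0, hy, hz, hyz⟩ := exists_two_sided_geodesic (rels := rels) 1 1
  have h1 := hy 0 one_pos
  have h2 := hz 0 one_pos
  rw [hy0] at h1
  rw [hz0] at h2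
  have hne : y (0 + 1) ≠ z (0 + 1) := by
    intro h
    have := hyz 1 le_rfl 1 le_rfl
    rw [show y 1 = z 1 from h, SimpleGraph.dist_self] at this
    omega
  rw [cayleyDegree, ← Set.ncard_pair hne]
  refine Set.ncard_le_ncard ?_ (cayleyGraph_neighborSet_finite 1)
  rintro v (rfl | rfl)
  · exact h1
  · exact h2

theorem edgeBoundary_two_edges [Finite α]
    [Infinite (PresentedGroup (rels : Set (FreeGroup α)))]
    {K : Set (PresentedGroup (rels : Set (FreeGroup α)))} (hK : K.Finite) (hne : K.Nonempty) :
    ∃ e ∈ edgeBoundary (cayleyGraph rels) K, ∃ f ∈ edgeBoundary (cayleyGraph rels) K, e ≠ f := by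
  obtain ⟨o, ho⟩ := hne
  obtain ⟨n, hn⟩ := exists_dist_lt (cayleyGraph rels) o hK
  obtain ⟨y, z, hy0, hz0, hy, hz, hyz⟩ := exists_two_sided_geodesic (rels := rels) o n
  obtain ⟨⟨j, hj, hj1, hj2⟩, i, hi, hi1, hi2⟩ := exists_crossings hy0 hz0 hyz ho hn
  refine ⟨⟨s(y j, y (j + 1)), hy j hj⟩, ⟨_, _, hj1, hj2, rfl⟩,
    ⟨s(z i, z (i + 1)), hz i hi⟩, ⟨_, _, hi1, hi2, rfl⟩, fun h => ?_⟩
  have hmem : y (j + 1) ∈ s(z i, z (i + 1)) := by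
    have heq : s(y j, y (j + 1)) = s(z i, z (i + 1)) := congrArg Subtype.val h
    rw [← heq]
    simp
  have h1 := hyz i hi.le (j + 1) hj
  have h2 := hyz (i + 1) hi (j + 1) hj
  rcases Sym2.mem_iff.1 hmem with h | h
  · rw [h, SimpleGraph.dist_self] at h1
    omega
  · rw [h, SimpleGraph.dist_self] at h2
    omega

theorem tied_singleton {V : Type*} (G : SimpleGraph V) (o : V) : Tied G {o} := by
  rintro φ - u rfl v rfl
  rfl

/-- Otherwise the punctured balls are empty, so a tied cut would be a single edge; but both arms of
a geodesic cross it, at different edges. -/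
theorem one_le_maxRelatorLength_div_two [Finite α] [DecidableEq α]
    (hG : OneEnded (cayleyGraph rels)) : 1 ≤ maxRelatorLength rels / 2 := by
  classical
  have := hG.infinite
  have : (cayleyGraph rels).LocallyFinite := fun v => (cayleyGraph_neighborSet_finite v).fintype
  obtain ⟨K, h1, hK, hK1, hK2, -⟩ := exists_tied_hull cayleyGraph_connected.preconnected hG
    (Set.finite_singleton 1) (Set.singleton_nonempty 1) (tied_singleton _ 1)
  obtain ⟨e, he, f, hf, hne⟩ := edgeBoundary_two_edges hK ⟨1, h1 rfl⟩
  by_contra hlt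
  have h0 : maxRelatorLength rels / 2 = 0 := by omega
  have := edgeBoundary_connected hK1 hK2 (A := {e}) (by simpa using he) (by simp)
    (fun a _ b _ hb => by rw [h0, puncturedBall_zero] at hb; exact hb.elim)
  rw [← this] at hf
  exact hne hf.symm

end Cayley

/-! ### Vacant clusters surrounding a vertex -/

section Surrounding

variable {α : Type*} {rels : Finset (FreeGroup α)}
  {nb : (cayleyGraph rels).edgeSet → Finset (cayleyGraph rels).edgeSet}

variable (nb) in
/-- The linked edge sets that contain the edge boundary of a finite set of vertices around `o`. -/
def surrounding (o : PresentedGroup (rels : Set (FreeGroup α))) :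
    Set (Finset (cayleyGraph rels).edgeSet) :=
  {W | Linked nb W ∧ ∃ K : Set (PresentedGroup (rels : Set (FreeGroup α))),
    K.Finite ∧ o ∈ K ∧ edgeBoundary (cayleyGraph rels) K ⊆ W}

variable [DecidableEq (cayleyGraph rels).edgeSet]

theorem Grows.dist_le {k : ℕ}
    (hnb : ∀ e f, f ∈ nb e → f ∈ puncturedBall (cayleyGraph rels).lineGraph k e)
    {e : (cayleyGraph rels).edgeSet} {W : Finset (cayleyGraph rels).edgeSet}
    (h : Grows nb e W) : ∀ f ∈ W, ∀ u ∈ e.1, ∀ v ∈ f.1,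
      (cayleyGraph rels).dist u v ≤ (k + 1) * W.card := by
  induction h with
  | single =>
    intro f hf u hu v hv
    rw [Finset.mem_singleton.1 hf] at hv
    have := dist_le_one_of_mem hu hv
    simp
    omega
  | @insert W a _ ha ih =>
    intro f hf u hu v hv
    obtain ⟨⟨b, hb, hab⟩, haW⟩ := mem_outer.1 ha
    rw [Finset.card_insert_of_notMem haW, mul_add, mul_one]
    rcases Finset.mem_insert.1 hf with rfl | hf
    · obtain ⟨-, w, hw⟩ := hnb _ _ hab
      obtain ⟨c, hc⟩ : ∃ c, c ∈ b.1 := ⟨_, Sym2.out_fst_mem b.1⟩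
      have h1 := ih b hb u hu c hc
      have h2 := dist_le_of_lineGraph_walk cayleyGraph_connected w hc hv
      have h3 := (cayleyGraph_connected (rels := rels)).dist_triangle (u := u) (v := c) (w := v)
      omega
    · have := ih f hf u hu v hv
      omega

/-- A surrounding `W` meets both arms of a geodesic through `o`. Being linked, it has diameter at
most `(k+1)|W|`, so it contains an edge of one fixed arm at index `j ≤ (k+1)|W|`. For each `j` the
counting bound applies, and the slack in `x < 1/γ` pays for the sum over `j`. -/
theorem summable_surrounding [Finite α] [Infinite (PresentedGroup (rels : Set (FreeGroup α)))]
    {k D : ℕ} (hD2 : 2 ≤ D) (hs : ∀ a b, a ∈ nb b → b ∈ nb a) (hD : ∀ e, (nb e).card ≤ D)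
    (hnb : ∀ e f, f ∈ nb e → f ∈ puncturedBall (cayleyGraph rels).lineGraph k e)
    (o : PresentedGroup (rels : Set (FreeGroup α))) {x : ℝ} (hx0 : 0 ≤ x)
    (hx : x * animalRate D < 1) : Summable fun W : surrounding nb o => x ^ W.1.card := by
  have hγ : 0 < animalRate D := one_pos.trans (animalRate_gt_one hD2)
  -- Then `x^|W| = ρ^((k+1)|W|) γ^(-|W|) ≤ ρ^j γ^(-|W|)`.
  obtain ⟨ρ, hρ0, hρ1, hρ⟩ : ∃ ρ : ℝ, 0 ≤ ρ ∧ ρ < 1 ∧ ρ ^ (k + 1) = x * animalRate D := by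
    have h0 : 0 ≤ x * animalRate D := by positivity
    refine ⟨(x * animalRate D) ^ (((k + 1 : ℕ) : ℝ)⁻¹), by positivity,
      Real.rpow_lt_one h0 hx (by positivity), Real.rpow_inv_natCast_pow h0 (by omega)⟩
  refine summable_of_sum_le (c := 4 * (1 - ρ)⁻¹) (fun W => by positivity) fun T => ?_
  have hball : ∃ n, ∀ W ∈ T, ∃ K : Set (PresentedGroup (rels : Set (FreeGroup α))),
      (∀ v ∈ K, (cayleyGraph rels).dist o v < n) ∧ o ∈ K ∧
        edgeBoundary (cayleyGraph rels) K ⊆ W.1 := by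
    have : ∀ W : surrounding nb o, ∃ n, ∃ K : Set (PresentedGroup (rels : Set (FreeGroup α))),
        (∀ v ∈ K, (cayleyGraph rels).dist o v < n) ∧ o ∈ K ∧
          edgeBoundary (cayleyGraph rels) K ⊆ W.1 := by
      rintro ⟨W, -, K, hK, ho, hb⟩
      obtain ⟨n, hn⟩ := exists_dist_lt (cayleyGraph rels) o hK
      exact ⟨n, K, hn, ho, hb⟩
    choose n hn using this
    refine ⟨T.sup n, fun W hW => ?_⟩
    obtain ⟨K, h1, h2⟩ := hn W
    exact ⟨K, fun v hv => (h1 v hv).trans_le (Finset.le_sup hW), h2⟩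
  obtain ⟨n, hn⟩ := hball
  -- The geodesic depends on the finite set `T`, but the final bound does not, so no bi-infinite
  -- geodesic is needed.
  obtain ⟨y, z, hy0, hz0, hy, hz, hyz⟩ := exists_two_sided_geodesic (rels := rels) o n
  have hidx : ∀ W ∈ T, ∃ j : Fin n,
      ⟨s(y j, y (j + 1)), hy j j.2⟩ ∈ W.1 ∧ j ≤ (k + 1) * W.1.card := by
    intro W hW
    obtain ⟨K, hK, ho, hb⟩ := hn W hW
    obtain ⟨⟨j, hj, hj1, hj2⟩, i, hi, hi1, hi2⟩ := exists_crossings hy0 hz0 hyz ho hK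
    have he : (⟨s(y j, y (j + 1)), hy j hj⟩ : (cayleyGraph rels).edgeSet) ∈ W.1 :=
      hb ⟨_, _, hj1, hj2, rfl⟩
    have hf : (⟨s(z i, z (i + 1)), hz i hi⟩ : (cayleyGraph rels).edgeSet) ∈ W.1 :=
      hb ⟨_, _, hi1, hi2, rfl⟩
    refine ⟨⟨j, hj⟩, he, ?_⟩
    have h1 := (W.2.1.grows hf).dist_le hnb _ he (z i) (by simp) (y j) (by simp)
    have h2 := hyz i hi.le j hj.le
    simp only
    omega
  have hterm : ∀ W : surrounding nb o, x ^ W.1.card =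
      ρ ^ ((k + 1) * W.1.card) * (animalRate D)⁻¹ ^ W.1.card := by
    intro W
    rw [pow_mul, hρ, ← mul_pow, mul_assoc, mul_inv_cancel₀ hγ.ne', mul_one]
  classical
  let T' : Fin n → Finset (surrounding nb o) := fun j =>
    T.filter fun W => ⟨s(y j, y (j + 1)), hy j j.2⟩ ∈ W.1 ∧ j ≤ (k + 1) * W.1.card
  have hinner : ∀ j : Fin n, ∑ W ∈ T' j, x ^ W.1.card ≤ 4 * ρ ^ (j : ℕ) := by
    intro j
    have hmem : ∀ W ∈ T' j, ⟨s(y j, y (j + 1)), hy j j.2⟩ ∈ W.1 ∧ j ≤ (k + 1) * W.1.card :=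
      fun W hW => (Finset.mem_filter.1 hW).2
    calc ∑ W ∈ T' j, x ^ W.1.card
        ≤ ∑ W ∈ T' j, ρ ^ (j : ℕ) * (animalRate D)⁻¹ ^ W.1.card := by
          refine Finset.sum_le_sum fun W hW => ?_
          rw [hterm]
          gcongr ?_ * _
          exact pow_le_pow_of_le_one hρ0 hρ1.le (hmem W hW).2
      _ = ρ ^ (j : ℕ) * ∑ W ∈ (T' j).map (Function.Embedding.subtype _),
            (animalRate D)⁻¹ ^ W.card := by
          rw [← Finset.mul_sum, Finset.sum_map]
          rfl
      _ ≤ ρ ^ (j : ℕ) * 4 := by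
          gcongr
          refine sum_grows_le hD2 hs hD ⟨s(y j, y (j + 1)), hy j j.2⟩ _ fun W hW => ?_
          obtain ⟨U, hU, rfl⟩ := Finset.mem_map.1 hW
          exact U.2.1.grows (hmem U hU).1
      _ = _ := mul_comm _ _
  calc ∑ W ∈ T, x ^ W.1.card
      ≤ ∑ W ∈ T, ∑ j : Fin n, if W ∈ T' j then x ^ W.1.card else 0 := by
        refine Finset.sum_le_sum fun W hW => ?_
        obtain ⟨j, hj⟩ := hidx W hW
        refine le_trans (le_of_eq ?_) (Finset.single_le_sum (a := j)
          (fun i _ => by split_ifs <;> positivity) (Finset.mem_univ j))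
        rw [if_pos (Finset.mem_filter.2 ⟨hW, hj⟩)]
    _ = ∑ j, ∑ W ∈ T' j, x ^ W.1.card := by
        rw [Finset.sum_comm]
        refine Finset.sum_congr rfl fun j _ => ?_
        rw [← Finset.sum_filter, Finset.filter_mem_eq_inter,
          Finset.inter_eq_right.2 (Finset.filter_subset _ _)]
    _ ≤ ∑ j : Fin n, 4 * ρ ^ (j : ℕ) := Finset.sum_le_sum fun j _ => hinner j
    _ = 4 * ∑ j ∈ Finset.range n, ρ ^ j := by
        rw [← Finset.mul_sum, Fin.sum_univ_eq_sum_range fun j => ρ ^ j]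
    _ ≤ 4 * (1 - ρ)⁻¹ := by
        rw [← tsum_geometric_of_lt_one hρ0 hρ1]
        gcongr
        exact (summable_geometric_of_lt_one hρ0 hρ1).sum_le_tsum _ fun j _ => by positivity

end Surrounding

/-! ### Finite clusters -/

section FiniteClusters

theorem mem_cluster_of_adj {V : Type*} {G : SimpleGraph V} {ω : G.edgeSet → Bool} {o u v : V}
    (hu : u ∈ cluster G ω o) (h : G.Adj u v) (hω : ω ⟨s(u, v), h⟩ = true) :
    v ∈ cluster G ω o := by
  refine SimpleGraph.Reachable.trans hu (SimpleGraph.Adj.reachable ?_)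
  rw [occupied, SimpleGraph.fromEdgeSet_adj]
  exact ⟨⟨h, hω⟩, h.ne⟩

theorem cluster_induction {V : Type*} {G : SimpleGraph V} {ω : G.edgeSet → Bool} {o : V}
    (P : V → Prop) (h0 : P o) (hstep : ∀ u v, ∀ h : G.Adj u v, u ∈ cluster G ω o →
      ω ⟨s(u, v), h⟩ = true → P u → P v) : ∀ v ∈ cluster G ω o, P v := by
  have key : ∀ u v, (occupied G ω).Walk u v → u ∈ cluster G ω o → P u → P v := by
    intro u v w
    induction w with
    | nil => exact fun _ h => h
    | @cons u x v hadj w ih =>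
      intro hu hP
      rw [occupied, SimpleGraph.fromEdgeSet_adj] at hadj
      obtain ⟨⟨h, hω⟩, -⟩ := hadj
      exact ih (mem_cluster_of_adj hu h hω) (hstep u x h hu hω hP)
  rintro v ⟨w⟩
  exact key o v w (SimpleGraph.Reachable.refl o) h0

theorem tied_cluster {V : Type*} {G : SimpleGraph V} (ω : G.edgeSet → Bool) (o : V) :
    Tied G (cluster G ω o) := by
  intro φ hφ
  have : ∀ v ∈ cluster G ω o, φ v = φ o := cluster_induction _ rfl fun u v h hu hω hP =>
    (hφ u hu v (mem_cluster_of_adj hu h hω) h).symm.trans hP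
  exact fun u hu v hv => (this u hu).trans (this v hv).symm

variable {α : Type*} {rels : Finset (FreeGroup α)}
  {nb : (cayleyGraph rels).edgeSet → Finset (cayleyGraph rels).edgeSet}
  [DecidableEq (cayleyGraph rels).edgeSet]

/-- The boundary of the filled cluster is vacant and linked, so it lies in one vacant cluster,
finite by `hω`. Conversely, an occupied path cannot cross a vacant boundary. -/
theorem cluster_finite_iff [Finite α] [DecidableEq α] (hG : OneEnded (cayleyGraph rels))
    (hs : ∀ a b, a ∈ nb b → b ∈ nb a)
    (hnb : ∀ e f, f ∈ nb e ↔
      f ∈ puncturedBall (cayleyGraph rels).lineGraph (maxRelatorLength rels / 2) e)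
    {ω : (cayleyGraph rels).edgeSet → Bool} (hω : ∀ e, ω ∉ vacantInfinite nb e)
    (o : PresentedGroup (rels : Set (FreeGroup α))) :
    (cluster (cayleyGraph rels) ω o).Finite ↔ ∃ W ∈ surrounding nb o, ω ∈ isolated nb W := by
  have ho : o ∈ cluster (cayleyGraph rels) ω o := SimpleGraph.Reachable.refl o
  constructor
  · intro hfin
    have := hG.infinite
    have : (cayleyGraph rels).LocallyFinite := fun v => (cayleyGraph_neighborSet_finite v).fintype
    obtain ⟨K, hCK, hK, hK1, hK2, hK3⟩ := exists_tied_hull cayleyGraph_connected.preconnected hG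
      hfin ⟨o, ho⟩ (tied_cluster ω o)
    have hvac : ∀ e ∈ edgeBoundary (cayleyGraph rels) K, ω e = false := by
      rintro ⟨e, he⟩ ⟨u, v, hu, hv, rfl⟩
      by_contra hne
      exact hv (hCK (mem_cluster_of_adj (hK3 u hu v hv he) he (by simpa using hne)))
    obtain ⟨e, he, -⟩ := edgeBoundary_two_edges hK ⟨o, hCK ho⟩
    have hnot := hω e
    simp only [vacantInfinite, Set.mem_ofPred_eq, not_forall] at hnot
    obtain ⟨n, hn⟩ := hnot
    rcases exists_grows_card_or_closed (nb := nb) (B := {a | ω a = false}) (hvac e he) n with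
      ⟨W, hW, hWv, hc⟩ | ⟨W, hW, hWv, hcl⟩
    · exact absurd ⟨W, hW, fun a ha => hWv ha, hc⟩ hn
    · have hiso : ω ∈ isolated nb W :=
        ⟨fun a ha => hWv ha, fun a ha => by simpa using hcl a ha⟩
      refine ⟨W, ⟨hW.linked hs, K, hK, hCK ho, ?_⟩, hiso⟩
      have := edgeBoundary_connected hK1 hK2
        (A := edgeBoundary (cayleyGraph rels) K ∩ W) Set.inter_subset_left
        ⟨e, he, hW.mem⟩ (fun a ha b hb hab => by
          refine ⟨hb, ?_⟩
          by_contra hbW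
          exact hcl b (mem_outer.2 ⟨⟨a, ha.2, (hnb a b).2 hab⟩, hbW⟩) (hvac b hb))
      exact Set.inter_eq_left.1 this
  · rintro ⟨W, ⟨-, K, hK, hoK, hKW⟩, hiso⟩
    refine hK.subset (cluster_induction _ hoK fun u v h _ hω hu => ?_)
    by_contra hv
    have := hiso.1 ⟨s(u, v), h⟩ (hKW ⟨u, v, hu, hv, rfl⟩)
    rw [this] at hω
    cases hω

end FiniteClusters

/-! ### The percolation density -/

section Main

theorem analyticOn_theta {α : Type*} [Finite α] [DecidableEq α]
    {rels : Finset (FreeGroup α)} (hG : OneEnded (cayleyGraph rels))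
    (o : PresentedGroup (rels : Set (FreeGroup α))) {D : ℕ} (hD2 : 2 ≤ D)
    (hD : D = (2 * cayleyDegree rels - 2) ^ (maxRelatorLength rels / 2)) :
    AnalyticOn ℝ (theta (cayleyGraph rels) o) (Set.Ioc (1 - 1 / animalRate D) 1) := by
  classical
  have hinf := hG.infinite
  have hcount := countable_presentedGroup (rels := rels)
  have hdeg := two_le_cayleyDegree (rels := rels)
  have hball := puncturedBall_finite_ncard (G := (cayleyGraph rels).lineGraph)
    (Δ := 2 * cayleyDegree rels - 2) (by omega)
    (lineGraph_degree fun v => ⟨cayleyGraph_neighborSet_finite v,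
      (cayleyGraph_neighborSet_ncard v).le⟩) (maxRelatorLength rels / 2)
  let nb : (cayleyGraph rels).edgeSet → Finset (cayleyGraph rels).edgeSet :=
    fun e => (hball e).1.toFinset
  have hnb : ∀ e f, f ∈ nb e ↔
      f ∈ puncturedBall (cayleyGraph rels).lineGraph (maxRelatorLength rels / 2) e :=
    fun e f => by simp [nb]
  have hs : ∀ a b, a ∈ nb b → b ∈ nb a := fun a b h => by
    rw [hnb] at h ⊢
    exact mem_puncturedBall_comm.1 h
  have hcard : ∀ e, (nb e).card ≤ D := fun e => by
    rw [hD]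
    refine le_trans (le_of_eq ?_) (hball e).2
    rw [Set.ncard_eq_toFinset_card _ (hball e).1]
  have hγ := animalRate_gt_one hD2
  have hγ0 : 0 < animalRate D := one_pos.trans hγ
  have hcountE : Countable (cayleyGraph rels).edgeSet := by
    have : Countable (Sym2 (PresentedGroup (rels : Set (FreeGroup α)))) :=
      inferInstanceAs (Countable (Quot _))
    infer_instance
  refine (analyticOn_measure_forall_notMem_isolated (nb := nb) (𝒲 := surrounding nb o) hD2 hcard
    (fun W hW => hW.1) fun x hx0 hx => summable_surrounding hD2 hs hcard
      (fun e f => (hnb e f).1) o hx0 hx).congr fun p hp => ?_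
  have hp0 : 0 ≤ p := by
    have : 1 / animalRate D < 1 := by rwa [div_lt_one hγ0]
    linarith [hp.1]
  have hproj : ((Set.projIcc 0 1 zero_le_one p : unitInterval) : ℝ) = p := by
    rw [Set.projIcc_of_mem _ ⟨hp0, hp.2⟩]
  have hsub : (1 - ((Set.projIcc 0 1 zero_le_one p : unitInterval) : ℝ)) * animalRate D < 1 := by
    rw [hproj]
    have := hp.1
    rw [sub_lt_comm, lt_div_iff₀ hγ0] at this
    exact this
  -- The characterisation of finite clusters holds only off this null set, which suffices for
  -- equality of probabilities.
  have hae : ∀ᵐ ω ∂bernoulliLaw (cayleyGraph rels).edgeSet (Set.projIcc 0 1 zero_le_one p),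
      ∀ e, ω ∉ vacantInfinite nb e :=
    ae_all_iff.2 fun e => measure_eq_zero_iff_ae_notMem.1
      (measure_vacantInfinite hD2 hs hcard e _ hsub)
  refine measureReal_congr ?_
  filter_upwards [hae] with ω hω
  have := cluster_finite_iff hG hs hnb hω o
  simp only [eq_iff_iff]
  change (cluster (cayleyGraph rels) ω o).Infinite ↔ ∀ W ∈ surrounding nb o, ω ∉ isolated nb W
  rw [Set.Infinite, this]
  push Not
  rfl

end Main

end BondPercolation

end

theorem mainTheorem3 {α : Type*} [Finite α] [DecidableEq α] (rels : Finset (FreeGroup α))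
    (hG : BondPercolation.OneEnded (BondPercolation.cayleyGraph rels))
    (o : PresentedGroup (rels : Set (FreeGroup α))) :
    AnalyticOn ℝ (BondPercolation.theta (BondPercolation.cayleyGraph rels) o)
        (Set.Ioc (1 - 1 / BondPercolation.gammaP rels) 1) ∧
      BondPercolation.pAnalytic (BondPercolation.cayleyGraph rels) o
        ≤ 1 - 1 / BondPercolation.gammaP rels ∧
      BondPercolation.pAnalytic (BondPercolation.cayleyGraph rels) o < 1 := by
  have hinf := hG.infinite
  have hdeg := BondPercolation.two_le_cayleyDegree (rels := rels)
  -- If `t / 2` were 0, then `D = 1` and `γ_P = 0`; this step secures `D ≥ 2`, hence `γ_P > 1`.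
  have hk := BondPercolation.one_le_maxRelatorLength_div_two hG
  obtain ⟨D, hD⟩ : ∃ D, D = (2 * BondPercolation.cayleyDegree rels - 2) ^
    (BondPercolation.maxRelatorLength rels / 2) := ⟨_, rfl⟩
  have hD2 : 2 ≤ D := by
    rw [hD]
    exact (by omega : 2 ≤ 2 * BondPercolation.cayleyDegree rels - 2).trans
      (Nat.le_self_pow (by omega) _)
  have hrate : BondPercolation.gammaP rels = BondPercolation.animalRate D := by
    rw [BondPercolation.gammaP, BondPercolation.animalRate, hD]
    push_cast [Nat.cast_sub (by omega : 2 ≤ 2 * BondPercolation.cayleyDegree rels)]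
    rfl
  have hmain := BondPercolation.analyticOn_theta hG o hD2 hD
  have hγ := BondPercolation.animalRate_gt_one hD2
  have hγ0 : 0 < BondPercolation.animalRate D := one_pos.trans hγ
  rw [hrate]
  have hpos : 0 < 1 / BondPercolation.animalRate D := by positivity
  have hlt : 1 / BondPercolation.animalRate D < 1 := by rwa [div_lt_one hγ0]
  have hle : BondPercolation.pAnalytic (BondPercolation.cayleyGraph rels) o ≤
      1 - 1 / BondPercolation.animalRate D :=
    csInf_le ⟨0, fun p hp => hp.1⟩ ⟨by linarith, by linarith, hmain⟩
  exact ⟨hmain, hle, by linarith⟩
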